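/- Let $G$ be a countable group and let $\omega$ be a free ultrafilter on $\mathbb N$. For a sequence of positive integers $(n_k)_k$ let $\Pi_{k\to\omega}P_{n_k}$ be the quotient of $\prod_k P_{n_k}$, where $P_n\cong\mathrm{Sym}(n)$ is the group of $n\times n$ permutation matrices, by the normal subgroup of those $(p_k)_k$ with $\lim_{k\to\omega}d_H(p_k,\mathrm{Id})=0$; here $d_H$ is the normalised Hamming distance. The class of $(p_k)_k$ is written $\Pi_{k\to\omega}p_k$, and $\mathrm{Tr}(\Pi_{k\to\omega}p_k)=\lim_{k\to\omega}\frac1{n_k}|\mathrm{Fix}(p_k)|$. A *sofic representation* of $G$ is a group morphism $\Theta:G\to\Pi_{k\to\omega}P_{n_k}$, for some sequence of positive integers with $\lim_k n_k=\infty$, such that $\mathrm{Tr}(\Theta(g))=0$ for all $g\neq 1$. Two sofic representations $\Theta:G\to\Pi_{k\to\omega}P_{n_k}$ and $\Psi:G\to\Pi_{k\to\omega}P_{m_k}$ are identified if there are sequences of positive integers $(r_k)_k,(t_k)_k$ with $n_kr_k=m_kt_k$ for all $k$ such that the amplifications $\Theta\otimes\mathrm{Id}_{r_k}$ and $\Psi\otimes\mathrm{Id}_{t_k}$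 are conjugate by an element of $\Pi_{k\to\omega}P_{n_kr_k}$. The set of classes $[\Theta]$ is denoted $Sof(G,P^\omega)$. For $\lambda\in[0,1]$ the convex combination $\lambda[\Theta]+(1-\lambda)[\Psi]$ is the class of the direct sum $(\Theta\otimes\mathrm{Id}_{m_kr_k})\oplus(\Psi\otimes\mathrm{Id}_{n_ks_k})$, where $r_k=\lfloor\lambda(k+1)\rfloor$ and $s_k=k+1-r_k$ (so that $r_k/(r_k+s_k)\to\lambda$); it is well defined. A *face* of $Sof(G,P^\omega)$ is a non-empty subset $F$ that is convex (i.e. $\lambda x+(1-\lambda)y\in F$ for all $x,y\in F$ and $\lambda\in[0,1]$) and such that, whenever $\lambda x+(1-\lambda)y\in F$ with $x,y\in Sof(G,P^\omega)$ and $0<\lambda<1$, both $x$ and $y$ belong to $F$. A face is *minimal* if it contains no strictly smaller face. A point $x$ is *extreme* if $x=\lambda y+(1-\lambda)z$ with $0<\lambda<1$ implies $y=z=x$. **Theorem.** The minimal faces of $Sof(G,P^\omega)$ are exactly the extreme points: a subset $F\subseteq Sof(G,P^\omega)$ is a minimal face if and only if $F=\{x\}$ for some extreme point $x$ of $Sof(G,P^\omega)$.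 -/

import Mathlib

open Filter Topology

namespace SoficSpace

/-- Normalised Hamming distance on the symmetric group of a finite set. -/
noncomputable def hammingDist {X : Type} [Fintype X] [DecidableEq X]
    (σ τ : Equiv.Perm X) : ℝ :=
  ((Finset.univ.filter fun i => σ i ≠ τ i).card : ℝ) / (Fintype.card X : ℝ)

/-- Normalised trace of a permutation matrix: the proportion of fixed points. -/
noncomputable def normTrace {X : Type} [Fintype X] [DecidableEq X] (σ : Equiv.Perm X) : ℝ :=
  ((Finset.univ.filter fun i => σ i = i).card : ℝ) / (Fintype.card X : ℝ)

theorem hammingDist_nonneg {X : Type} [Fintype X] [DecidableEq X] (σ τ : Equiv.Perm X) :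
    0 ≤ hammingDist σ τ := by unfold hammingDist; positivity

theorem normTrace_nonneg {X : Type} [Fintype X] [DecidableEq X] (σ : Equiv.Perm X) :
    0 ≤ normTrace σ := by unfold normTrace; positivity

theorem hammingDist_one {X : Type} [Fintype X] [DecidableEq X] (σ : Equiv.Perm X) :
    hammingDist σ 1
      = ((Finset.univ.filter fun i => σ i ≠ i).card : ℝ) / (Fintype.card X : ℝ) := rfl

theorem hammingDist_mul_one {X : Type} [Fintype X] [DecidableEq X] (σ τ : Equiv.Perm X) :
    hammingDist (σ * τ) 1 ≤ hammingDist σ 1 + hammingDist τ 1 := by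
  simp only [hammingDist_one]
  rw [← add_div]
  gcongr
  rw [← Nat.cast_add]
  norm_cast
  refine le_trans (Finset.card_le_card ?_) (Finset.card_union_le _ _)
  intro i hi
  simp only [Finset.mem_filter, Finset.mem_univ, true_and, Finset.mem_union] at hi ⊢
  by_contra! h
  exact hi (by rw [Equiv.Perm.mul_apply, h.2, h.1])

theorem hammingDist_inv_one {X : Type} [Fintype X] [DecidableEq X] (σ : Equiv.Perm X) :
    hammingDist σ⁻¹ 1 = hammingDist σ 1 := by
  simp only [hammingDist_one]
  congr 3
  ext i
  simp only [Finset.mem_filter, Finset.mem_univ, true_and, ne_eq]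
  rw [Equiv.Perm.inv_eq_iff_eq, eq_comm]

theorem hammingDist_permCongr_one {X Y : Type} [Fintype X] [DecidableEq X] [Fintype Y]
    [DecidableEq Y] (e : X ≃ Y) (σ : Equiv.Perm X) :
    hammingDist (e.permCongr σ) 1 = hammingDist σ 1 := by
  simp only [hammingDist_one]
  rw [Fintype.card_congr e]
  congr 2
  refine Finset.card_bij' (fun y _ => e.symm y) (fun x _ => e x) ?_ ?_ ?_ ?_ <;>
    simp [Equiv.permCongr_apply, ← Equiv.eq_symm_apply]

theorem normTrace_permCongr {X Y : Type} [Fintype X] [DecidableEq X] [Fintype Y]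
    [DecidableEq Y] (e : X ≃ Y) (σ : Equiv.Perm X) :
    normTrace (e.permCongr σ) = normTrace σ := by
  unfold normTrace
  rw [Fintype.card_congr e]
  congr 2
  refine Finset.card_bij' (fun y _ => e.symm y) (fun x _ => e x) ?_ ?_ ?_ ?_ <;>
    simp [Equiv.permCongr_apply, ← Equiv.eq_symm_apply]

/-- The amplification `σ ⊗ Id_T`, acting on `X × T` by `(i, j) ↦ (σ i, j)`. -/
def permAmp (X T : Type) : Equiv.Perm X →* Equiv.Perm (X × T) where
  toFun σ := Equiv.prodCongr σ (Equiv.refl T)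
  map_one' := by ext <;> rfl
  map_mul' _ _ := by ext <;> rfl

theorem hammingDist_permAmp_one {X T : Type} [Fintype X] [DecidableEq X] [Fintype T]
    [DecidableEq T] (σ : Equiv.Perm X) :
    hammingDist (permAmp X T σ) 1 ≤ hammingDist σ 1 := by
  simp only [hammingDist_one]
  have h : (Finset.univ.filter fun i : X × T =>
      permAmp X T σ i ≠ i)
      = (Finset.univ.filter fun i : X => σ i ≠ i) ×ˢ Finset.univ := by
    ext ⟨i, j⟩
    simp [permAmp]
  rw [h, Finset.card_product, Fintype.card_prod, Finset.card_univ]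
  push_cast
  rcases Nat.eq_zero_or_pos (Fintype.card T) with h0 | h0
  · rw [h0]; simp; positivity
  · rw [mul_div_mul_right _ _ (by positivity)]

theorem hammingDist_sum_one {X Y : Type} [Fintype X] [DecidableEq X] [Fintype Y]
    [DecidableEq Y] (σ : Equiv.Perm X) (τ : Equiv.Perm Y) :
    hammingDist (Equiv.Perm.sumCongrHom X Y (σ, τ)) 1 ≤ hammingDist σ 1 + hammingDist τ 1 := by
  simp only [hammingDist_one]
  have h : (Finset.univ.filter fun i : X ⊕ Y =>
      Equiv.Perm.sumCongrHom X Y (σ, τ) i ≠ i)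
      = (Finset.univ.filter fun i : X => σ i ≠ i).disjSum
        (Finset.univ.filter fun i : Y => τ i ≠ i) := by
    ext (i | i) <;> simp [Equiv.Perm.sumCongrHom]
  rw [h, Finset.card_disjSum, Fintype.card_sum]
  push_cast
  rw [add_div]
  refine add_le_add ?_ ?_
  · rcases isEmpty_or_nonempty X with hX | hX
    · simp
    · have : 0 < Fintype.card X := Fintype.card_pos
      gcongr; simp
  · rcases isEmpty_or_nonempty Y with hY | hY
    · simp
    · have : 0 < Fintype.card Y := Fintype.card_pos
      gcongr; simp

theorem normTrace_amp_sum_le {X Y S T : Type} [Fintype X] [DecidableEq X] [Fintype Y]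
    [DecidableEq Y] [Fintype S] [DecidableEq S] [Fintype T] [DecidableEq T]
    (σ : Equiv.Perm X) (τ : Equiv.Perm Y) :
    normTrace (Equiv.Perm.sumCongrHom (X × S) (Y × T) (permAmp X S σ, permAmp Y T τ))
      ≤ normTrace σ + normTrace τ := by
  unfold normTrace
  have h : (Finset.univ.filter fun i : X × S ⊕ Y × T =>
      Equiv.Perm.sumCongrHom (X × S) (Y × T) (permAmp X S σ, permAmp Y T τ) i = i)
      = ((Finset.univ.filter fun i : X => σ i = i) ×ˢ (Finset.univ : Finset S)).disjSum
        ((Finset.univ.filter fun i : Y => τ i = i) ×ˢ (Finset.univ : Finset T)) := by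
    ext (i | i) <;> rcases i with ⟨i, j⟩ <;> simp [Equiv.Perm.sumCongrHom, permAmp]
  have key : ∀ a x s B : ℝ, 0 ≤ a → 0 ≤ x → 0 ≤ s → 0 ≤ B → (x = 0 → a = 0) →
      a * s / (x * s + B) ≤ a / x := by
    intro a x s B ha hx hs hB h0
    rcases hx.eq_or_lt with hx | hx
    · rw [h0 hx.symm]; simp
    rcases hs.eq_or_lt with hs | hs
    · rw [← hs]; simp; positivity
    rw [div_le_div_iff₀ (by positivity) hx]
    nlinarith [mul_nonneg ha hB]
  rw [h, Finset.card_disjSum, Fintype.card_sum, Finset.card_product, Finset.card_product,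
    Fintype.card_prod, Fintype.card_prod, Finset.card_univ, Finset.card_univ]
  push_cast
  rw [add_div]
  refine add_le_add ?_ ?_
  · refine key _ _ _ _ (by positivity) (by positivity) (by positivity) (by positivity) ?_
    intro h0
    have : IsEmpty X := Fintype.card_eq_zero_iff.1 (by exact_mod_cast h0)
    simp
  · rw [add_comm]
    refine key _ _ _ _ (by positivity) (by positivity) (by positivity) (by positivity) ?_
    intro h0
    have : IsEmpty Y := Fintype.card_eq_zero_iff.1 (by exact_mod_cast h0)
    simp

/-- Sequences of permutations `(p_k)` with `lim_{k → ω} d_H(p_k, Id) = 0`. -/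
def nullSubgroup (ω : Ultrafilter ℕ) (X : ℕ → Type) [∀ k, Fintype (X k)]
    [∀ k, DecidableEq (X k)] : Subgroup (∀ k, Equiv.Perm (X k)) where
  carrier := {p | Tendsto (fun k => hammingDist (p k) 1) ω (𝓝 0)}
  one_mem' := by simp [hammingDist]
  mul_mem' {p q} hp hq := by
    have h : Tendsto (fun k => hammingDist (p k) 1 + hammingDist (q k) 1) ω (𝓝 0) := by
      simpa using Tendsto.add hp hq
    exact squeeze_zero (fun k => hammingDist_nonneg _ _)
      (fun k => hammingDist_mul_one (p k) (q k)) h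
  inv_mem' {p} hp := by
    simpa only [Set.mem_ofPred_eq, Pi.inv_apply, hammingDist_inv_one] using hp

instance nullSubgroup_normal (ω : Ultrafilter ℕ) (X : ℕ → Type) [∀ k, Fintype (X k)]
    [∀ k, DecidableEq (X k)] : (nullSubgroup ω X).Normal where
  conj_mem p hp q := by
    change Tendsto (fun k => hammingDist (p k) 1) ω (𝓝 0) at hp
    change Tendsto (fun k => hammingDist ((q * p * q⁻¹) k) 1) ω (𝓝 0)
    have h : ∀ k, hammingDist ((q * p * q⁻¹) k) 1 = hammingDist (p k) 1 := fun k =>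
      hammingDist_permCongr_one (q k) (p k)
    simpa only [h] using hp

/-- The ultraproduct of the symmetric groups `Sym(X_k)` along `ω`, with respect to the
normalised Hamming distance. For `X_k = {1, …, n_k}` this is the universal sofic group
`Π_{k → ω} P_{n_k}`. -/
abbrev UProd (ω : Ultrafilter ℕ) (X : ℕ → Type) [∀ k, Fintype (X k)]
    [∀ k, DecidableEq (X k)] : Type :=
  (∀ k, Equiv.Perm (X k)) ⧸ nullSubgroup ω X

/-- The element `Π_{k → ω} p_k`. -/
abbrev UProd.mk (ω : Ultrafilter ℕ) {X : ℕ → Type} [∀ k, Fintype (X k)]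
    [∀ k, DecidableEq (X k)] (p : ∀ k, Equiv.Perm (X k)) : UProd ω X :=
  QuotientGroup.mk p

/-- `Tr(x) = c`, where `Tr(Π_{k → ω} p_k) = lim_{k → ω} Tr(p_k)`. -/
def HasTrace {ω : Ultrafilter ℕ} {X : ℕ → Type} [∀ k, Fintype (X k)]
    [∀ k, DecidableEq (X k)] (x : UProd ω X) (c : ℝ) : Prop :=
  ∃ p : ∀ k, Equiv.Perm (X k), UProd.mk ω p = x ∧
    Tendsto (fun k => normTrace (p k)) ω (𝓝 c)

/-- The morphism of ultraproducts induced by contractive coordinate morphisms. -/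
def UProd.map (ω : Ultrafilter ℕ) {X Y : ℕ → Type} [∀ k, Fintype (X k)]
    [∀ k, DecidableEq (X k)] [∀ k, Fintype (Y k)] [∀ k, DecidableEq (Y k)]
    (f : ∀ k, Equiv.Perm (X k) →* Equiv.Perm (Y k))
    (hf : ∀ k σ, hammingDist (f k σ) 1 ≤ hammingDist σ 1) : UProd ω X →* UProd ω Y :=
  QuotientGroup.map _ _ (MonoidHom.pi fun k => (f k).comp (Pi.evalMonoidHom _ k)) (by
    intro p hp
    exact squeeze_zero (fun k => hammingDist_nonneg _ _) (fun k => hf k (p k)) hp)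

section Operations

variable {G : Type*} [Group G] {ω : Ultrafilter ℕ} {X Y Z W S T : ℕ → Type}
  [∀ k, Fintype (X k)] [∀ k, DecidableEq (X k)] [∀ k, Fintype (Y k)] [∀ k, DecidableEq (Y k)]
  [∀ k, Fintype (Z k)] [∀ k, DecidableEq (Z k)] [∀ k, Fintype (W k)] [∀ k, DecidableEq (W k)]
  [∀ k, Fintype (S k)] [∀ k, DecidableEq (S k)] [∀ k, Fintype (T k)] [∀ k, DecidableEq (T k)]

/-- Relabelling (conjugation) along bijections `e_k : X_k → Y_k`:
`Π p_k ↦ Π e_k p_k e_k⁻¹`. -/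
def reindex (ω : Ultrafilter ℕ) (e : ∀ k, X k ≃ Y k) : UProd ω X →* UProd ω Y :=
  UProd.map ω (fun k => (e k).permCongrHom.toMonoidHom)
    (fun k σ => (hammingDist_permCongr_one (e k) σ).le)

/-- `Π p_k ↦ Π (p_k ⊗ Id_{T_k})`. -/
def amplify (ω : Ultrafilter ℕ) (X T : ℕ → Type) [∀ k, Fintype (X k)]
    [∀ k, DecidableEq (X k)] [∀ k, Fintype (T k)] [∀ k, DecidableEq (T k)] :
    UProd ω X →* UProd ω (fun k => X k × T k) :=
  UProd.map ω (fun k => permAmp (X k) (T k)) (fun _ σ => hammingDist_permAmp_one σ)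

/-- `(Π p_k, Π q_k) ↦ Π (p_k ⊕ q_k)`. -/
def dsum (ω : Ultrafilter ℕ) (X Y : ℕ → Type) [∀ k, Fintype (X k)]
    [∀ k, DecidableEq (X k)] [∀ k, Fintype (Y k)] [∀ k, DecidableEq (Y k)] :
    UProd ω X × UProd ω Y →* UProd ω (fun k => X k ⊕ Y k) where
  toFun x := Quotient.map₂
    (fun p q k => Equiv.Perm.sumCongrHom (X k) (Y k) (p k, q k)) (by
      intro p p' hp q q' hq
      rw [← Quotient.eq_iff_equiv] at hp hq ⊢
      have hp' := QuotientGroup.eq.1 hp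
      have hq' := QuotientGroup.eq.1 hq
      refine QuotientGroup.eq.2 ?_
      have h : Tendsto (fun k => hammingDist ((p⁻¹ * p') k) 1 + hammingDist ((q⁻¹ * q') k) 1) ω
          (𝓝 0) := by simpa using Tendsto.add hp' hq'
      refine squeeze_zero (fun k => hammingDist_nonneg _ _) (fun k => ?_) h
      have := hammingDist_sum_one ((p⁻¹ * p') k) ((q⁻¹ * q') k)
      convert this using 2
      simp only [Pi.mul_apply, Pi.inv_apply]
      rw [← map_inv, ← map_mul]
      rfl) x.1 x.2
  map_one' := by
    change UProd.mk ω _ = UProd.mk ω _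
    congr 1
    funext k
    exact map_one _
  map_mul' := by
    rintro ⟨x, y⟩ ⟨x', y'⟩
    induction x using QuotientGroup.induction_on
    induction y using QuotientGroup.induction_on
    induction x' using QuotientGroup.induction_on
    induction y' using QuotientGroup.induction_on
    change UProd.mk ω _ = UProd.mk ω _
    congr 1
    funext k
    exact map_mul (Equiv.Perm.sumCongrHom (X k) (Y k)) (_, _) (_, _)

/-- Two morphisms into ultraproducts of symmetric groups are conjugate if some element
`Π_{k → ω} e_k`, made of bijections `e_k : X_k → Y_k`, conjugates one into the other
(so in particular `X_k` and `Y_k` have the same size). -/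
def Conj (Θ : G →* UProd ω X) (Ψ : G →* UProd ω Y) : Prop :=
  ∃ e : ∀ k, X k ≃ Y k, ∀ g, reindex ω e (Θ g) = Ψ g

/-- `Θ ⊗ Id_{T_k}`. -/
def amp (T : ℕ → Type) [∀ k, Fintype (T k)] [∀ k, DecidableEq (T k)]
    (Θ : G →* UProd ω X) : G →* UProd ω (fun k => X k × T k) :=
  (amplify ω X T).comp Θ

/-- `Θ ⊕ Ψ`. -/
def directSum (Θ : G →* UProd ω X) (Ψ : G →* UProd ω Y) :
    G →* UProd ω (fun k => X k ⊕ Y k) :=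
  (dsum ω X Y).comp (Θ.prod Ψ)

theorem Conj.refl (Θ : G →* UProd ω X) : Conj Θ Θ := by
  refine ⟨fun k => Equiv.refl _, fun g => ?_⟩
  induction Θ g using QuotientGroup.induction_on
  rfl

theorem Conj.trans {Θ : G →* UProd ω X} {Ψ : G →* UProd ω Y} {Φ : G →* UProd ω Z}
    (h : Conj Θ Ψ) (h' : Conj Ψ Φ) : Conj Θ Φ := by
  obtain ⟨e, he⟩ := h
  obtain ⟨f, hf⟩ := h'
  refine ⟨fun k => (e k).trans (f k), fun g => ?_⟩
  rw [← hf, ← he]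
  induction Θ g using QuotientGroup.induction_on
  rfl

theorem Conj.symm {Θ : G →* UProd ω X} {Ψ : G →* UProd ω Y} (h : Conj Θ Ψ) : Conj Ψ Θ := by
  obtain ⟨e, he⟩ := h
  refine ⟨fun k => (e k).symm, fun g => ?_⟩
  rw [← he]
  induction Θ g using QuotientGroup.induction_on
  change UProd.mk ω _ = UProd.mk ω _
  congr 1
  funext k
  change (e k).symm.permCongr ((e k).permCongr _) = _
  ext i
  simp

theorem Conj.amp {Θ : G →* UProd ω X} {Ψ : G →* UProd ω Y} (h : Conj Θ Ψ)
    (u : ∀ k, S k ≃ T k) : Conj (amp S Θ) (amp T Ψ) := by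
  obtain ⟨e, he⟩ := h
  refine ⟨fun k => (e k).prodCongr (u k), fun g => ?_⟩
  change _ = amplify ω Y T (Ψ g)
  rw [← he]
  change reindex ω _ (amplify ω X S (Θ g)) = _
  induction Θ g using QuotientGroup.induction_on
  change UProd.mk ω _ = UProd.mk ω _
  congr 1
  funext k
  change ((e k).prodCongr (u k)).permCongr (permAmp _ _ _) = permAmp _ _ ((e k).permCongr _)
  ext ⟨i, j⟩ <;> simp [permAmp]

theorem Conj.directSum {Θ : G →* UProd ω X} {Ψ : G →* UProd ω Y} {Θ' : G →* UProd ω Z}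
    {Ψ' : G →* UProd ω W} (h : Conj Θ Θ') (h' : Conj Ψ Ψ') :
    Conj (directSum Θ Ψ) (directSum Θ' Ψ') := by
  obtain ⟨e, he⟩ := h
  obtain ⟨f, hf⟩ := h'
  refine ⟨fun k => (e k).sumCongr (f k), fun g => ?_⟩
  change _ = dsum ω Z W (Θ' g, Ψ' g)
  rw [← he, ← hf]
  change reindex ω _ (dsum ω X Y (Θ g, Ψ g)) = _
  induction Θ g using QuotientGroup.induction_on
  induction Ψ g using QuotientGroup.induction_on
  change UProd.mk ω _ = UProd.mk ω _
  congr 1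
  funext k
  change ((e k).sumCongr (f k)).permCongr (Equiv.Perm.sumCongrHom _ _ (_, _))
    = Equiv.Perm.sumCongrHom _ _ ((e k).permCongr _, (f k).permCongr _)
  ext (i | i) <;> simp [Equiv.Perm.sumCongrHom]

theorem conj_amp_amp (Θ : G →* UProd ω X) :
    Conj (amp T (amp S Θ)) (amp (fun k => S k × T k) Θ) := by
  refine ⟨fun k => Equiv.prodAssoc _ _ _, fun g => ?_⟩
  change reindex ω _ (amplify ω _ T (amplify ω X S (Θ g))) = amplify ω X _ (Θ g)
  induction Θ g using QuotientGroup.induction_on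
  change UProd.mk ω _ = UProd.mk ω _
  congr 1

theorem conj_amp_directSum (Θ : G →* UProd ω X) (Ψ : G →* UProd ω Y) :
    Conj (amp T (directSum Θ Ψ)) (directSum (amp T Θ) (amp T Ψ)) := by
  refine ⟨fun k => Equiv.sumProdDistrib _ _ _, fun g => ?_⟩
  change reindex ω _ (amplify ω _ T (dsum ω X Y (Θ g, Ψ g)))
    = dsum ω _ _ (amplify ω X T (Θ g), amplify ω Y T (Ψ g))
  induction Θ g using QuotientGroup.induction_on
  induction Ψ g using QuotientGroup.induction_on
  change UProd.mk ω _ = UProd.mk ω _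
  congr 1
  funext k
  ext (⟨i, j⟩ | ⟨i, j⟩) <;> rfl

end Operations

/-- A sofic representation of `G`: a morphism `Θ : G → Π_{k → ω} P_{n_k}`, with `n_k ≥ 1` and
`lim_k n_k = ∞`, such that `Tr(Θ(g)) = 0` for every `g ≠ 1`. -/
structure SoficRep (ω : Ultrafilter ℕ) (G : Type*) [Group G] where
  dim : ℕ → ℕ
  dim_pos : ∀ k, 0 < dim k
  tendsto_dim : Tendsto dim atTop atTop
  hom : G →* UProd ω (fun k => Fin (dim k))
  trace_zero : ∀ g : G, g ≠ 1 → HasTrace (hom g) 0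

/-- `Θ` and `Ψ` define the same class if they have conjugate amplifications: there are
sequences of positive integers `r_k`, `t_k` with `n_k r_k = m_k t_k` such that `Θ ⊗ Id_{r_k}`
and `Ψ ⊗ Id_{t_k}` are conjugate in `Π_{k → ω} P_{n_k r_k}`. -/
def SoficRep.Equivalent {ω : Ultrafilter ℕ} {G : Type*} [Group G] (Θ Ψ : SoficRep ω G) : Prop :=
  ∃ r t : ℕ → ℕ, (∀ k, 0 < r k) ∧ (∀ k, 0 < t k) ∧
    Conj (amp (fun k => Fin (r k)) Θ.hom) (amp (fun k => Fin (t k)) Ψ.hom)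

theorem SoficRep.Equivalent.trans {ω : Ultrafilter ℕ} {G : Type*} [Group G]
    {Θ Ψ Φ : SoficRep ω G} (h : Θ.Equivalent Ψ) (h' : Ψ.Equivalent Φ) : Θ.Equivalent Φ := by
  obtain ⟨a, b, ha, hb, h⟩ := h
  obtain ⟨c, d, hc, hd, h'⟩ := h'
  refine ⟨fun k => a k * c k, fun k => d k * b k, fun k => Nat.mul_pos (ha k) (hc k),
    fun k => Nat.mul_pos (hd k) (hb k), ?_⟩
  have h1 : Conj (SoficSpace.amp (fun k => Fin (a k * c k)) Θ.hom)
      (SoficSpace.amp (fun k => Fin (c k)) (SoficSpace.amp (fun k => Fin (a k)) Θ.hom)) :=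
    ((Conj.refl Θ.hom).amp (fun k => finProdFinEquiv.symm)).trans (conj_amp_amp _).symm
  have h2 := h.amp (fun k => Equiv.refl (Fin (c k)))
  have h3 : Conj (SoficSpace.amp (fun k => Fin (c k)) (SoficSpace.amp (fun k => Fin (b k)) Ψ.hom))
      (SoficSpace.amp (fun k => Fin (b k)) (SoficSpace.amp (fun k => Fin (c k)) Ψ.hom)) :=
    ((conj_amp_amp _).trans ((Conj.refl Ψ.hom).amp (fun k => Equiv.prodComm _ _))).trans
      (conj_amp_amp _).symm
  have h4 := h'.amp (fun k => Equiv.refl (Fin (b k)))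
  have h5 : Conj (SoficSpace.amp (fun k => Fin (b k)) (SoficSpace.amp (fun k => Fin (d k)) Φ.hom))
      (SoficSpace.amp (fun k => Fin (d k * b k)) Φ.hom) :=
    (conj_amp_amp _).trans ((Conj.refl Φ.hom).amp (fun k => finProdFinEquiv))
  exact h1.trans (h2.trans (h3.trans (h4.trans h5)))

instance SoficRep.setoid (ω : Ultrafilter ℕ) (G : Type*) [Group G] : Setoid (SoficRep ω G) where
  r := SoficRep.Equivalent
  iseqv :=
    { refl := fun _ => ⟨fun _ => 1, fun _ => 1, fun _ => one_pos, fun _ => one_pos, Conj.refl _⟩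
      symm := fun ⟨r, t, hr, ht, h⟩ => ⟨t, r, ht, hr, h.symm⟩
      trans := SoficRep.Equivalent.trans }

/-- The space `Sof(G, P^ω)` of classes of sofic representations. -/
def Sof (ω : Ultrafilter ℕ) (G : Type*) [Group G] : Type _ := Quotient (SoficRep.setoid ω G)

/-- `⌊t (k + 1)⌋`; together with `weightR` these are natural numbers with sum `k + 1` and
`weightL t k / (k + 1) → t`. -/
noncomputable def weightL (t : unitInterval) (k : ℕ) : ℕ := ⌊(t : ℝ) * ((k : ℝ) + 1)⌋₊

noncomputable def weightR (t : unitInterval) (k : ℕ) : ℕ := k + 1 - weightL t k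

theorem weightL_add_weightR (t : unitInterval) (k : ℕ) : weightL t k + weightR t k = k + 1 := by
  have h : weightL t k ≤ k + 1 := by
    unfold weightL
    refine Nat.floor_le_of_le ?_
    push_cast
    nlinarith [t.2.1, t.2.2, (Nat.cast_nonneg k : (0 : ℝ) ≤ k)]
  unfold weightR
  omega

/-- For `Θ` in dimensions `n_k` and `Ψ` in dimensions `m_k`, the representation
`((Θ ⊗ Id_{m_k}) ⊗ Id_{r_k}) ⊕ ((Ψ ⊗ Id_{n_k}) ⊗ Id_{s_k})` in dimensions
`n_k m_k (r_k + s_k)`, where `r_k / (r_k + s_k) → t`; it represents `t [Θ] + (1 - t) [Ψ]`. -/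
noncomputable def SoficRep.comb {ω : Ultrafilter ℕ} {G : Type*} [Group G] (t : unitInterval)
    (Θ Ψ : SoficRep ω G) : SoficRep ω G where
  dim k := Θ.dim k * (Ψ.dim k * weightL t k) + Ψ.dim k * (Θ.dim k * weightR t k)
  dim_pos k := by
    have h1 := Θ.dim_pos k
    have h2 := Ψ.dim_pos k
    have h : Θ.dim k * (Ψ.dim k * weightL t k) + Ψ.dim k * (Θ.dim k * weightR t k)
        = Θ.dim k * Ψ.dim k * (k + 1) := by rw [← weightL_add_weightR t k]; ring
    rw [h]
    positivity
  tendsto_dim := by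
    refine tendsto_atTop_mono (fun k => ?_) Θ.tendsto_dim
    have h : Θ.dim k * (Ψ.dim k * weightL t k) + Ψ.dim k * (Θ.dim k * weightR t k)
        = Θ.dim k * (Ψ.dim k * (k + 1)) := by rw [← weightL_add_weightR t k]; ring
    rw [h]
    exact Nat.le_mul_of_pos_right _ (Nat.mul_pos (Ψ.dim_pos k) k.succ_pos)
  hom := (reindex ω (fun _ =>
      (Equiv.sumCongr finProdFinEquiv finProdFinEquiv).trans finSumFinEquiv)).comp
    (directSum (amp (fun k => Fin (Ψ.dim k * weightL t k)) Θ.hom)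
      (amp (fun k => Fin (Θ.dim k * weightR t k)) Ψ.hom))
  trace_zero g hg := by
    obtain ⟨p, hp, hp'⟩ := Θ.trace_zero g hg
    obtain ⟨q, hq, hq'⟩ := Ψ.trace_zero g hg
    refine ⟨fun k => Equiv.permCongr
      ((Equiv.sumCongr finProdFinEquiv finProdFinEquiv).trans finSumFinEquiv)
      (Equiv.Perm.sumCongrHom _ _ (permAmp _ (Fin (Ψ.dim k * weightL t k)) (p k),
        permAmp _ (Fin (Θ.dim k * weightR t k)) (q k))), ?_, ?_⟩
    · change _ = reindex ω _ (dsum ω _ _ (amplify ω _ _ (Θ.hom g), amplify ω _ _ (Ψ.hom g)))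
      rw [← hp, ← hq]
      rfl
    · have h : Tendsto (fun k => normTrace (p k) + normTrace (q k)) ω (𝓝 0) := by
        simpa using hp'.add hq'
      refine squeeze_zero (fun k => normTrace_nonneg _) (fun k => ?_) h
      rw [normTrace_permCongr]
      exact normTrace_amp_sum_le (p k) (q k)

theorem SoficRep.conj_comb {ω : Ultrafilter ℕ} {G : Type*} [Group G] (t : unitInterval)
    (Θ Ψ : SoficRep ω G) :
    Conj (directSum (amp (fun k => Fin (Ψ.dim k * weightL t k)) Θ.hom)
      (amp (fun k => Fin (Θ.dim k * weightR t k)) Ψ.hom)) (SoficRep.comb t Θ Ψ).hom :=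
  ⟨_, fun _ => rfl⟩

theorem card_eq_of_conj {ω : Ultrafilter ℕ} {G : Type*} [Group G] {n m r t : ℕ → ℕ}
    {Θ : G →* UProd ω (fun k => Fin (n k))} {Ψ : G →* UProd ω (fun k => Fin (m k))}
    (h : Conj (amp (fun k => Fin (r k)) Θ) (amp (fun k => Fin (t k)) Ψ)) (k : ℕ) :
    n k * r k = m k * t k := by
  obtain ⟨e, -⟩ := h
  simpa using Fintype.card_congr (e k)

/-- Amplifying twice by integers, in terms of any integers with the same product. -/
theorem conj_amp_amp_of_eq {ω : Ultrafilter ℕ} {G : Type*} [Group G] {X : ℕ → Type}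
    [∀ k, Fintype (X k)] [∀ k, DecidableEq (X k)] (Θ : G →* UProd ω X) {a b c d : ℕ → ℕ}
    (h : ∀ k, a k * b k = c k * d k) :
    Conj (amp (fun k => Fin (b k)) (amp (fun k => Fin (a k)) Θ))
      (amp (fun k => Fin (d k)) (amp (fun k => Fin (c k)) Θ)) :=
  ((conj_amp_amp _).trans ((Conj.refl Θ).amp (fun k =>
    (finProdFinEquiv.trans (finCongr (h k))).trans finProdFinEquiv.symm))).trans
    (conj_amp_amp _).symm

theorem SoficRep.Equivalent.comb {ω : Ultrafilter ℕ} {G : Type*} [Group G] (t : unitInterval)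
    {Θ Θ' Ψ Ψ' : SoficRep ω G} (h : Θ.Equivalent Θ') (h' : Ψ.Equivalent Ψ') :
    (SoficRep.comb t Θ Ψ).Equivalent (SoficRep.comb t Θ' Ψ') := by
  obtain ⟨a, b, ha, hb, h⟩ := h
  obtain ⟨c, d, hc, hd, h'⟩ := h'
  have e1 := card_eq_of_conj h
  have e2 := card_eq_of_conj h'
  refine ⟨fun k => a k * c k, fun k => b k * d k, fun k => Nat.mul_pos (ha k) (hc k),
    fun k => Nat.mul_pos (hb k) (hd k), ?_⟩
  have key : Conj (SoficSpace.amp (fun k => Fin (a k * c k)) (directSum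
        (SoficSpace.amp (fun k => Fin (Ψ.dim k * weightL t k)) Θ.hom)
        (SoficSpace.amp (fun k => Fin (Θ.dim k * weightR t k)) Ψ.hom)))
      (SoficSpace.amp (fun k => Fin (b k * d k)) (directSum
        (SoficSpace.amp (fun k => Fin (Ψ'.dim k * weightL t k)) Θ'.hom)
        (SoficSpace.amp (fun k => Fin (Θ'.dim k * weightR t k)) Ψ'.hom))) := by
    refine (conj_amp_directSum _ _).trans (Conj.trans (Conj.directSum ?_ ?_)
      (conj_amp_directSum _ _).symm)
    · have h1 := conj_amp_amp_of_eq Θ.hom (a := fun k => Ψ.dim k * weightL t k)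
        (b := fun k => a k * c k) (c := a) (d := fun k => Ψ.dim k * c k * weightL t k)
        (fun k => by ring)
      have h2 := h.amp (fun k => Equiv.refl (Fin (Ψ.dim k * c k * weightL t k)))
      have h3 := conj_amp_amp_of_eq Θ'.hom (a := b)
        (b := fun k => Ψ.dim k * c k * weightL t k)
        (c := fun k => Ψ'.dim k * weightL t k) (d := fun k => b k * d k)
        (fun k => by rw [e2 k]; ring)
      exact h1.trans (h2.trans h3)
    · have h1 := conj_amp_amp_of_eq Ψ.hom (a := fun k => Θ.dim k * weightR t k)
        (b := fun k => a k * c k) (c := c) (d := fun k => Θ.dim k * a k * weightR t k)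
        (fun k => by ring)
      have h2 := h'.amp (fun k => Equiv.refl (Fin (Θ.dim k * a k * weightR t k)))
      have h3 := conj_amp_amp_of_eq Ψ'.hom (a := d)
        (b := fun k => Θ.dim k * a k * weightR t k)
        (c := fun k => Θ'.dim k * weightR t k) (d := fun k => b k * d k)
        (fun k => by rw [e1 k]; ring)
      exact h1.trans (h2.trans h3)
  exact ((SoficRep.conj_comb t Θ Ψ).symm.amp (fun k => Equiv.refl _)).trans
    (key.trans ((SoficRep.conj_comb t Θ' Ψ').amp (fun k => Equiv.refl _)))

/-- The convex combination `t x + (1 - t) y` in `Sof(G, P^ω)`. -/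
noncomputable def Sof.comb {ω : Ultrafilter ℕ} {G : Type*} [Group G] (t : unitInterval)
    (x y : Sof ω G) : Sof ω G :=
  Quotient.map₂ (SoficRep.comb t) (fun _ _ h _ _ h' => SoficRep.Equivalent.comb t h h') x y

section Faces

variable {ω : Ultrafilter ℕ} {G : Type*} [Group G]

/-- A face: a non-empty convex subset that contains `x` and `y` as soon as it contains
`t x + (1 - t) y` for some `0 < t < 1`. -/
structure IsFace (F : Set (Sof ω G)) : Prop where
  nonempty : F.Nonempty
  convex : ∀ x ∈ F, ∀ y ∈ F, ∀ t : unitInterval, Sof.comb t x y ∈ F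
  extremal : ∀ (x y : Sof ω G) (t : unitInterval), 0 < t → t < 1 →
    Sof.comb t x y ∈ F → x ∈ F ∧ y ∈ F

/-- A face that contains no strictly smaller face. -/
def IsMinimalFace (F : Set (Sof ω G)) : Prop :=
  IsFace F ∧ ∀ F' : Set (Sof ω G), IsFace F' → F' ⊆ F → F' = F

/-- An extreme point: it is no proper convex combination other than the trivial one. -/
def IsExtremePoint (x : Sof ω G) : Prop :=
  ∀ (y z : Sof ω G) (t : unitInterval), 0 < t → t < 1 → Sof.comb t y z = x → y = x ∧ z = x

end Faces

end SoficSpace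

/-!
Every minimal face is a singleton; the rest of the theorem is formal. If a face `F` contains
`x ≠ y`, extend the segment from `y` through `x` as far as possible, to a last point `w`
(`exists_comb_eq_notMem_faceOf`). Then `w ∈ F`, and the face generated by `w` does not contain
`y`, since otherwise the segment could be extended beyond `w`. So `F` contains a strictly smaller face.

This uses two properties of `Sof(G, P^ω)`.

* The operations `Sof.comb` obey the identities of convex combinations. They all follow from one
  principle: a class is determined by the weights with which it is mixed from given
  representations (`IsMix.unique`), and weights combine linearly (`IsMix.comb`). The principle
  holds because two block sums of amplifications with nearly equal proportions can be matched
  identically on all but a small part of the points (`exists_defect_blockAmp_le`).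
* The weights `t` for which `x = t y + (1 - t) z` has a solution `z` form a closed set
  (`Sof.isClosed_setOf_comb_eq`): if `z_j` are solutions for weights `t_j → t`, a diagonal choice
  `z_{J k}` at stage `k`, with `J k → ∞` slowly along `ω`, assembles a solution for `t`. This is
  where the countability of `G` enters.

Morphisms into ultraproducts are handled through lifts to sequences of permutations, and
conjugacy through the proportion of points at which a bijection fails to be equivariant (`defect`).
-/

open Filter Topology

set_option linter.unusedSectionVars false

namespace SoficSpace

/-! ### Almost equivariant bijections -/

/-- The proportion of points of `X` at which `e : X ≃ Y` fails to intertwine `p` and `q`. -/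
noncomputable def defect {X Y : Type} [Fintype X] [DecidableEq Y] (e : X ≃ Y)
    (p : Equiv.Perm X) (q : Equiv.Perm Y) : ℝ :=
  ((Finset.univ.filter fun x => e (p x) ≠ q (e x)).card : ℝ) / (Fintype.card X : ℝ)

section Defect

variable {X Y Z W T : Type} [Fintype X] [DecidableEq X] [Fintype Y] [DecidableEq Y]
  [Fintype Z] [DecidableEq Z] [Fintype W] [DecidableEq W] [Fintype T] [DecidableEq T]

theorem defect_nonneg (e : X ≃ Y) (p : Equiv.Perm X) (q : Equiv.Perm Y) : 0 ≤ defect e p q := by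
  unfold defect; positivity

theorem defect_eq_hammingDist (e : X ≃ Y) (p : Equiv.Perm X) (q : Equiv.Perm Y) :
    defect e p q = hammingDist (e.permCongr p) q := by
  unfold defect hammingDist
  rw [Fintype.card_congr e]
  congr 2
  refine Finset.card_bij' (fun x _ => e x) (fun y _ => e.symm y) ?_ ?_ ?_ ?_
  · intro x hx
    rw [Finset.mem_filter] at hx ⊢
    simpa [Equiv.permCongr_apply] using hx
  · intro y hy
    rw [Finset.mem_filter] at hy ⊢
    simpa [Equiv.permCongr_apply] using hy
  · simp
  · simp

theorem defect_eq_zero {e : X ≃ Y} {p : Equiv.Perm X} {q : Equiv.Perm Y}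
    (h : ∀ x, e (p x) = q (e x)) : defect e p q = 0 := by
  simp [defect, h]

theorem defect_trans (e : X ≃ Y) (f : Y ≃ Z) (p : Equiv.Perm X) (q : Equiv.Perm Y)
    (r : Equiv.Perm Z) : defect (e.trans f) p r ≤ defect e p q + defect f q r := by
  have h : (Finset.univ.filter fun y => f (q y) ≠ r (f y)).card
      = (Finset.univ.filter fun x => f (q (e x)) ≠ r (f (e x))).card := by
    refine Finset.card_bij' (fun y _ => e.symm y) (fun x _ => e x) ?_ ?_ ?_ ?_ <;> simp
  unfold defect
  rw [h, ← Fintype.card_congr e, ← add_div]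
  gcongr
  norm_cast
  refine le_trans (Finset.card_le_card ?_) (Finset.card_union_le _ _)
  intro x hx
  rw [Finset.mem_filter] at hx
  rw [Finset.mem_union, Finset.mem_filter, Finset.mem_filter]
  by_contra! hh
  refine hx.2 ?_
  rw [Equiv.trans_apply, Equiv.trans_apply, hh.1 (Finset.mem_univ x), hh.2 (Finset.mem_univ x)]

theorem defect_symm (e : X ≃ Y) (p : Equiv.Perm X) (q : Equiv.Perm Y) :
    defect e.symm q p = defect e p q := by
  unfold defect
  rw [Fintype.card_congr e]
  congr 2
  refine Finset.card_bij' (fun y _ => e.symm y) (fun x _ => e x) ?_ ?_ ?_ ?_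
  · intro y hy
    simp only [Finset.mem_filter, Finset.mem_univ, true_and, ne_eq, Equiv.apply_symm_apply] at hy ⊢
    exact fun hh => hy (by rw [← hh, Equiv.symm_apply_apply])
  · intro x hx
    simp only [Finset.mem_filter, Finset.mem_univ, true_and, ne_eq, Equiv.symm_apply_apply] at hx ⊢
    exact fun hh => hx (by rw [← hh, Equiv.apply_symm_apply])
  · simp
  · simp

theorem defect_permAmp_le (e : X ≃ Y) (p : Equiv.Perm X) (q : Equiv.Perm Y) :
    defect (e.prodCongr (Equiv.refl T)) (permAmp X T p) (permAmp Y T q) ≤ defect e p q := by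
  have h : (Finset.univ.filter fun z : X × T => (e.prodCongr (Equiv.refl T)) (permAmp X T p z)
        ≠ permAmp Y T q ((e.prodCongr (Equiv.refl T)) z))
      = (Finset.univ.filter fun x : X => e (p x) ≠ q (e x)) ×ˢ Finset.univ := by
    ext ⟨i, j⟩
    simp [permAmp]
  unfold defect
  rw [h, Finset.card_product, Fintype.card_prod, Finset.card_univ]
  push_cast
  rcases Nat.eq_zero_or_pos (Fintype.card T) with h0 | h0
  · rw [h0]; simp; positivity
  · rw [mul_div_mul_right _ _ (by positivity)]

theorem defect_sum_le (e : X ≃ Y) (f : Z ≃ W) (p : Equiv.Perm X) (q : Equiv.Perm Y)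
    (r : Equiv.Perm Z) (s : Equiv.Perm W) :
    defect (e.sumCongr f) (Equiv.Perm.sumCongrHom X Z (p, r)) (Equiv.Perm.sumCongrHom Y W (q, s))
      ≤ defect e p q + defect f r s := by
  have h : (Finset.univ.filter fun z : X ⊕ Z =>
        (e.sumCongr f) (Equiv.Perm.sumCongrHom X Z (p, r) z)
          ≠ Equiv.Perm.sumCongrHom Y W (q, s) ((e.sumCongr f) z))
      = (Finset.univ.filter fun x => e (p x) ≠ q (e x)).disjSum
        (Finset.univ.filter fun x => f (r x) ≠ s (f x)) := by
    ext (i | i) <;> simp [Equiv.Perm.sumCongrHom]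
  unfold defect
  rw [h, Finset.card_disjSum, Fintype.card_sum]
  push_cast
  rw [add_div]
  refine add_le_add ?_ ?_
  · rcases isEmpty_or_nonempty X with hX | hX
    · simp
    · have : 0 < Fintype.card X := Fintype.card_pos
      gcongr; simp
  · rcases isEmpty_or_nonempty Z with hZ | hZ
    · simp
    · have : 0 < Fintype.card Z := Fintype.card_pos
      gcongr; simp

theorem abs_normTrace_sub_le (p q : Equiv.Perm X) :
    |normTrace p - normTrace q| ≤ hammingDist p q := by
  have key : ∀ p q : Equiv.Perm X, normTrace p ≤ normTrace q + hammingDist p q := by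
    intro p q
    unfold normTrace hammingDist
    rw [← add_div]
    gcongr
    norm_cast
    refine le_trans (Finset.card_le_card ?_) (Finset.card_union_le _ _)
    intro i hi
    simp only [Finset.mem_filter, Finset.mem_univ, true_and, Finset.mem_union] at hi ⊢
    by_contra! h
    exact h.1 (by rw [← h.2, hi])
  have hc : hammingDist q p = hammingDist p q := by
    simp only [hammingDist, ne_comm]
  rw [abs_le]
  constructor
  · linarith [key q p]
  · linarith [key p q]

theorem normTrace_permAmp_le (p : Equiv.Perm X) :
    normTrace (permAmp X T p) ≤ normTrace p := by
  have h : (Finset.univ.filter fun i : X × T => permAmp X T p i = i)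
      = (Finset.univ.filter fun i : X => p i = i) ×ˢ Finset.univ := by
    ext ⟨i, j⟩
    simp [permAmp]
  unfold normTrace
  rw [h, Finset.card_product, Fintype.card_prod, Finset.card_univ]
  push_cast
  rcases Nat.eq_zero_or_pos (Fintype.card T) with h0 | h0
  · rw [h0]; simp; positivity
  · rw [mul_div_mul_right _ _ (by positivity)]

end Defect

section Blocks

variable {ι : Type} [Fintype ι] [DecidableEq ι] {X : ι → Type} [∀ i, Fintype (X i)]
  [∀ i, DecidableEq (X i)]

/-- The block sum of the permutations `p_i ⊗ Id_{a_i}`. -/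
def blockAmp (a : ι → ℕ) (p : ∀ i, Equiv.Perm (X i)) :
    Equiv.Perm (Σ i, X i × Fin (a i)) :=
  Equiv.Perm.sigmaCongrRight fun i => permAmp (X i) (Fin (a i)) (p i)

/-- Two block sums of amplifications of the same permutations, of the same total size, are
intertwined by a bijection up to the difference of the multiplicities: the common copies of each
block are matched identically and the remaining points arbitrarily. -/
theorem exists_defect_blockAmp_le (a b : ι → ℕ)
    (hab : ∑ i, Fintype.card (X i) * a i = ∑ i, Fintype.card (X i) * b i) :
    ∃ e : (Σ i, X i × Fin (a i)) ≃ (Σ i, X i × Fin (b i)),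
      ∀ p : ∀ i, Equiv.Perm (X i), defect e (blockAmp a p) (blockAmp b p)
        ≤ ∑ i, |(Fintype.card (X i) * a i : ℝ) / (∑ j, Fintype.card (X j) * a j : ℕ)
          - (Fintype.card (X i) * b i : ℝ) / (∑ j, Fintype.card (X j) * b j : ℕ)| := by
  classical
  have cardA : Fintype.card (Σ i, X i × Fin (a i)) = ∑ i, Fintype.card (X i) * a i := by simp
  have cardB : Fintype.card (Σ i, X i × Fin (b i)) = ∑ i, Fintype.card (X i) * b i := by simp
  rcases isEmpty_or_nonempty (Σ i, X i × Fin (b i)) with hE | ⟨⟨d⟩⟩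
  · have hA : Fintype.card (Σ i, X i × Fin (a i)) = 0 := by
      rw [cardA, hab, ← cardB]; exact Fintype.card_eq_zero
    refine ⟨Fintype.equivOfCardEq (by rw [cardA, cardB, hab]), fun p => ?_⟩
    rw [defect, (Nat.cast_eq_zero (R := ℝ)).2 hA, div_zero]
    exact Finset.sum_nonneg fun i _ => abs_nonneg _
  let s : Finset (Σ i, X i × Fin (a i)) := Finset.univ.filter fun z => (z.2.2 : ℕ) < b z.1
  let f : (Σ i, X i × Fin (a i)) → (Σ i, X i × Fin (b i)) := fun z =>
    if h : (z.2.2 : ℕ) < b z.1 then ⟨z.1, z.2.1, ⟨(z.2.2 : ℕ), h⟩⟩ else d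
  have hf : ∀ i (x : X i) (j : Fin (a i)) (h : (j : ℕ) < b i),
      f ⟨i, x, j⟩ = ⟨i, x, ⟨(j : ℕ), h⟩⟩ := fun i x j h => dif_pos h
  have hs : ∀ i (x : X i) (j : Fin (a i)), (⟨i, x, j⟩ : Σ i, X i × Fin (a i)) ∈ s ↔ (j : ℕ) < b i := by
    intro i x j; simp [s]
  obtain ⟨g, hg⟩ := Finset.exists_equiv_extend_of_card_eq (t := (Finset.univ : Finset
    (Σ i, X i × Fin (b i)))) (by rw [Finset.card_univ, cardA, cardB, hab]) (s := s) (f := f)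
    (Finset.subset_univ _) (by
      rintro ⟨i, x, j⟩ hi ⟨i', x', j'⟩ hi' hh
      have h1 := (hs i x j).1 hi
      have h2 := (hs i' x' j').1 hi'
      rw [hf _ _ _ h1, hf _ _ _ h2] at hh
      obtain rfl : i = i' := congrArg Sigma.fst hh
      simp only [Sigma.mk.injEq, heq_eq_eq, Prod.mk.injEq, Fin.mk.injEq, true_and] at hh
      rw [hh.1, Fin.ext hh.2])
  let e : (Σ i, X i × Fin (a i)) ≃ (Σ i, X i × Fin (b i)) :=
    g.trans (Equiv.subtypeUnivEquiv (fun x => Finset.mem_univ x))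
  have he : ∀ z ∈ s, e z = f z := hg
  refine ⟨e, fun p => ?_⟩
  have hbad : (Finset.univ.filter fun z => e (blockAmp a p z) ≠ blockAmp b p (e z))
      ⊆ Finset.univ.sigma fun i => (Finset.univ : Finset (X i)) ×ˢ
        (Finset.univ.filter fun j : Fin (a i) => ¬ (j : ℕ) < b i) := by
    rintro ⟨i, x, j⟩ hz
    simp only [Finset.mem_filter, Finset.mem_univ, true_and, Finset.mem_sigma,
      Finset.mem_product] at hz ⊢
    intro hj
    refine hz ?_
    rw [he ⟨i, x, j⟩ ((hs i x j).2 hj), hf i x j hj]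
    change e ⟨i, p i x, j⟩ = ⟨i, p i x, _⟩
    rw [he ⟨i, p i x, j⟩ ((hs i _ j).2 hj), hf i _ j hj]
    rfl
  have hcount : ∀ i, ((Finset.univ.filter fun j : Fin (a i) => ¬ (j : ℕ) < b i).card : ℝ)
      ≤ |(a i : ℝ) - b i| := by
    intro i
    have h1 : (Finset.univ.filter fun j : Fin (a i) => ¬ (j : ℕ) < b i).card ≤ a i - b i := by
      have : ((Finset.univ.filter fun j : Fin (a i) => ¬ (j : ℕ) < b i).map Fin.valEmbedding)
          ⊆ Finset.Ico (b i) (a i) := by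
        intro j hj
        simp only [Finset.mem_map, Finset.mem_filter, Finset.mem_univ, true_and] at hj
        obtain ⟨j, hj, rfl⟩ := hj
        simp only [Fin.valEmbedding_apply, Finset.mem_Ico]
        omega
      simpa using Finset.card_le_card this
    rcases le_total (b i) (a i) with h | h
    · refine le_trans ?_ (le_abs_self _)
      rw [← Nat.cast_sub h]
      exact_mod_cast h1
    · have : (Finset.univ.filter fun j : Fin (a i) => ¬ (j : ℕ) < b i).card = 0 := by omega
      rw [this]; simp
  unfold defect
  rw [cardA, ← hab]
  calc _ ≤ ((∑ i, Fintype.card (X i) *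
          (Finset.univ.filter fun j : Fin (a i) => ¬ (j : ℕ) < b i).card : ℕ) : ℝ)
          / (∑ j, Fintype.card (X j) * a j : ℕ) := by
        gcongr
        refine (Finset.card_le_card hbad).trans (le_of_eq ?_)
        simp only [Finset.card_sigma, Finset.card_product, Finset.card_univ]
    _ ≤ _ := by
        push_cast
        rw [Finset.sum_div]
        refine Finset.sum_le_sum fun i _ => ?_
        rw [← sub_div, abs_div, ← mul_sub, abs_mul]
        rw [Nat.abs_cast, abs_of_nonneg (a := ∑ j, (Fintype.card (X j) : ℝ) * a j)
          (by positivity)]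
        gcongr
        exact hcount i

end Blocks

/-! ### Approximate conjugacy along the ultrafilter -/

theorem mk_eq_mk_iff {ω : Ultrafilter ℕ} {X : ℕ → Type} [∀ k, Fintype (X k)]
    [∀ k, DecidableEq (X k)] (p q : ∀ k, Equiv.Perm (X k)) :
    UProd.mk ω p = UProd.mk ω q ↔ Tendsto (fun k => hammingDist (p k) (q k)) ω (𝓝 0) := by
  have h : ∀ k, hammingDist ((p⁻¹ * q) k) 1 = hammingDist (p k) (q k) := by
    intro k
    unfold hammingDist
    congr 3
    ext i
    rw [Finset.mem_filter, Finset.mem_filter, Pi.mul_apply, Pi.inv_apply,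
      Equiv.Perm.mul_apply, Equiv.Perm.one_apply, ne_eq, Equiv.Perm.inv_eq_iff_eq, eq_comm]
  refine QuotientGroup.eq.trans ?_
  change Tendsto (fun k => hammingDist ((p⁻¹ * q) k) 1) ω (𝓝 0) ↔ _
  simp only [h]

section ApproxConj

variable {G : Type*} {ω : Ultrafilter ℕ} {X Y Z W : ℕ → Type}
  [∀ k, Fintype (X k)] [∀ k, DecidableEq (X k)] [∀ k, Fintype (Y k)] [∀ k, DecidableEq (Y k)]
  [∀ k, Fintype (Z k)] [∀ k, DecidableEq (Z k)] [∀ k, Fintype (W k)] [∀ k, DecidableEq (W k)]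

/-- Two families of sequences of permutations are approximately conjugate if a single sequence of
bijections intertwines them, for every index `g`, up to a proportion of points that vanishes
along `ω`. The index set carries no group structure: this is the relation between lifts that
corresponds to `Conj` between morphisms into ultraproducts. -/
def ApproxConj (ω : Ultrafilter ℕ) (P : G → ∀ k, Equiv.Perm (X k))
    (Q : G → ∀ k, Equiv.Perm (Y k)) : Prop :=
  ∃ e : ∀ k, X k ≃ Y k, ∀ g, Tendsto (fun k => defect (e k) (P g k) (Q g k)) ω (𝓝 0)

theorem ApproxConj.of_equivariant {P : G → ∀ k, Equiv.Perm (X k)}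
    {Q : G → ∀ k, Equiv.Perm (Y k)} (e : ∀ k, X k ≃ Y k)
    (h : ∀ g k x, e k (P g k x) = Q g k (e k x)) : ApproxConj ω P Q :=
  ⟨e, fun g => by simp only [defect_eq_zero (h g _), tendsto_const_nhds_iff]⟩

theorem ApproxConj.symm {P : G → ∀ k, Equiv.Perm (X k)} {Q : G → ∀ k, Equiv.Perm (Y k)}
    (h : ApproxConj ω P Q) : ApproxConj ω Q P := by
  obtain ⟨e, he⟩ := h
  exact ⟨fun k => (e k).symm, fun g => by simpa only [defect_symm] using he g⟩

theorem ApproxConj.trans {P : G → ∀ k, Equiv.Perm (X k)} {Q : G → ∀ k, Equiv.Perm (Y k)}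
    {R : G → ∀ k, Equiv.Perm (Z k)} (h : ApproxConj ω P Q) (h' : ApproxConj ω Q R) :
    ApproxConj ω P R := by
  obtain ⟨e, he⟩ := h
  obtain ⟨f, hf⟩ := h'
  refine ⟨fun k => (e k).trans (f k), fun g => ?_⟩
  exact squeeze_zero (fun _ => defect_nonneg _ _ _) (fun k => defect_trans _ _ _ (Q g k) _)
    (by simpa using (he g).add (hf g))

theorem ApproxConj.amp {P : G → ∀ k, Equiv.Perm (X k)} {Q : G → ∀ k, Equiv.Perm (Y k)}
    (h : ApproxConj ω P Q) (c : ℕ → ℕ) :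
    ApproxConj ω (fun g k => permAmp (X k) (Fin (c k)) (P g k))
      (fun g k => permAmp (Y k) (Fin (c k)) (Q g k)) := by
  obtain ⟨e, he⟩ := h
  exact ⟨fun k => (e k).prodCongr (Equiv.refl _), fun g =>
    squeeze_zero (fun _ => defect_nonneg _ _ _) (fun k => defect_permAmp_le _ _ _) (he g)⟩

theorem ApproxConj.sum {P : G → ∀ k, Equiv.Perm (X k)} {Q : G → ∀ k, Equiv.Perm (Y k)}
    {R : G → ∀ k, Equiv.Perm (Z k)} {S : G → ∀ k, Equiv.Perm (W k)}
    (h : ApproxConj ω P Q) (h' : ApproxConj ω R S) :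
    ApproxConj ω (fun g k => Equiv.Perm.sumCongrHom (X k) (Z k) (P g k, R g k))
      (fun g k => Equiv.Perm.sumCongrHom (Y k) (W k) (Q g k, S g k)) := by
  obtain ⟨e, he⟩ := h
  obtain ⟨f, hf⟩ := h'
  exact ⟨fun k => (e k).sumCongr (f k), fun g =>
    squeeze_zero (fun _ => defect_nonneg _ _ _) (fun k => defect_sum_le _ _ _ _ _ _)
      (by simpa using (he g).add (hf g))⟩

theorem ApproxConj.amp_amp (P : G → ∀ k, Equiv.Perm (X k)) {c d u : ℕ → ℕ}
    (h : ∀ k, c k * d k = u k) :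
    ApproxConj ω (fun g k => permAmp (X k × Fin (c k)) (Fin (d k))
        (permAmp (X k) (Fin (c k)) (P g k)))
      (fun g k => permAmp (X k) (Fin (u k)) (P g k)) :=
  .of_equivariant (fun k => (Equiv.prodAssoc _ _ _).trans
    (Equiv.prodCongr (Equiv.refl _) (finProdFinEquiv.trans (finCongr (h k))))) fun _ _ _ => rfl

theorem ApproxConj.amp_sum (P : G → ∀ k, Equiv.Perm (X k)) (Q : G → ∀ k, Equiv.Perm (Y k))
    (c : ℕ → ℕ) :
    ApproxConj ω (fun g k => permAmp (X k ⊕ Y k) (Fin (c k))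
        (Equiv.Perm.sumCongrHom (X k) (Y k) (P g k, Q g k)))
      (fun g k => Equiv.Perm.sumCongrHom (X k × Fin (c k)) (Y k × Fin (c k))
        (permAmp (X k) (Fin (c k)) (P g k), permAmp (Y k) (Fin (c k)) (Q g k))) :=
  .of_equivariant (fun _ => Equiv.sumProdDistrib _ _ _) (by rintro g k ⟨i | i, j⟩ <;> rfl)

section Blocks

variable {ι : Type} [Fintype ι] [DecidableEq ι] {B : ι → ℕ → Type} [∀ i k, Fintype (B i k)]
  [∀ i k, DecidableEq (B i k)]

theorem ApproxConj.amp_blockAmp (P : ∀ i, G → ∀ k, Equiv.Perm (B i k)) (a : ι → ℕ → ℕ)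
    (c : ℕ → ℕ) :
    ApproxConj ω (fun g k => permAmp (Σ i, B i k × Fin (a i k)) (Fin (c k))
        (blockAmp (fun i => a i k) fun i => P i g k))
      (fun g k => blockAmp (fun i => a i k * c k) fun i => P i g k) :=
  .of_equivariant (fun _ => (Equiv.sigmaProdDistrib _ _).trans (Equiv.sigmaCongrRight fun _ =>
    (Equiv.prodAssoc _ _ _).trans (Equiv.prodCongr (Equiv.refl _) finProdFinEquiv)))
    fun _ _ _ => rfl

theorem ApproxConj.sum_blockAmp (P : ∀ i, G → ∀ k, Equiv.Perm (B i k)) (a b : ι → ℕ → ℕ) :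
    ApproxConj ω (fun g k => Equiv.Perm.sumCongrHom (Σ i, B i k × Fin (a i k))
        (Σ i, B i k × Fin (b i k))
        (blockAmp (fun i => a i k) (fun i => P i g k), blockAmp (fun i => b i k) fun i => P i g k))
      (fun g k => blockAmp (fun i => a i k + b i k) fun i => P i g k) :=
  .of_equivariant (fun _ => (Equiv.sigmaSumDistrib _ _).symm.trans (Equiv.sigmaCongrRight fun _ =>
    (Equiv.prodSumDistrib _ _ _).symm.trans (Equiv.prodCongr (Equiv.refl _) finSumFinEquiv)))
    (by rintro g k (⟨i, x, j⟩ | ⟨i, x, j⟩) <;> rfl)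

/-- Block sums in which every block asymptotically takes up the same proportion of the points
are approximately conjugate. -/
theorem ApproxConj.blockAmp (P : ∀ i, G → ∀ k, Equiv.Perm (B i k)) (a b : ι → ℕ → ℕ)
    (hab : ∀ k, ∑ i, Fintype.card (B i k) * a i k = ∑ i, Fintype.card (B i k) * b i k)
    (w : ι → ℝ)
    (ha : ∀ i, Tendsto (fun k => (Fintype.card (B i k) * a i k : ℝ)
      / (∑ j, Fintype.card (B j k) * a j k : ℕ)) ω (𝓝 (w i)))
    (hb : ∀ i, Tendsto (fun k => (Fintype.card (B i k) * b i k : ℝ)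
      / (∑ j, Fintype.card (B j k) * b j k : ℕ)) ω (𝓝 (w i))) :
    ApproxConj ω (fun g k => SoficSpace.blockAmp (fun i => a i k) fun i => P i g k)
      (fun g k => SoficSpace.blockAmp (fun i => b i k) fun i => P i g k) := by
  -- the weights are compared block by block, and both converge to `w`
  choose e he using fun k => exists_defect_blockAmp_le (X := fun i => B i k)
    (fun i => a i k) (fun i => b i k) (hab k)
  refine ⟨e, fun g => squeeze_zero (fun _ => defect_nonneg _ _ _)
    (fun k => he k fun i => P i g k) ?_⟩
  have := tendsto_finsetSum (Finset.univ : Finset ι)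
    fun i _ => ((ha i).sub (hb i)).abs
  simpa using this

end Blocks

theorem conj_iff_approxConj [Group G] {Θ : G →* UProd ω X} {Ψ : G →* UProd ω Y}
    {P : G → ∀ k, Equiv.Perm (X k)} {Q : G → ∀ k, Equiv.Perm (Y k)}
    (hP : ∀ g, UProd.mk ω (P g) = Θ g) (hQ : ∀ g, UProd.mk ω (Q g) = Ψ g) :
    Conj Θ Ψ ↔ ApproxConj ω P Q := by
  refine exists_congr fun e => forall_congr' fun g => ?_
  rw [← hP, ← hQ]
  simp only [defect_eq_hammingDist]
  exact mk_eq_mk_iff (fun k => (e k).permCongr (P g k)) (Q g)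

end ApproxConj

/-! ### Convex combinations of finitely many sofic representations -/

section Mix

variable {G : Type*} [Group G] {ω : Ultrafilter ℕ}

/-- A choice of permutations representing `Θ(g)`. -/
noncomputable def SoficRep.lift (Θ : SoficRep ω G) (g : G) (k : ℕ) :
    Equiv.Perm (Fin (Θ.dim k)) :=
  Quotient.out (Θ.hom g) k

theorem SoficRep.mk_lift (Θ : SoficRep ω G) (g : G) : UProd.mk ω (Θ.lift g) = Θ.hom g :=
  Quotient.out_eq (Θ.hom g)

theorem SoficRep.mk_amp_lift (Θ : SoficRep ω G) (c : ℕ → ℕ) (g : G) :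
    UProd.mk ω (fun k => permAmp (Fin (Θ.dim k)) (Fin (c k)) (Θ.lift g k))
      = SoficSpace.amp (fun k => Fin (c k)) Θ.hom g := by
  change _ = amplify ω _ _ (Θ.hom g)
  rw [← Θ.mk_lift]
  rfl

theorem SoficRep.equivalent_iff {Θ Ψ : SoficRep ω G} :
    Θ ≈ Ψ ↔ ∃ r t : ℕ → ℕ, (∀ k, 0 < r k) ∧ (∀ k, 0 < t k) ∧
      ApproxConj ω (fun g k => permAmp (Fin (Θ.dim k)) (Fin (r k)) (Θ.lift g k))
        (fun g k => permAmp (Fin (Ψ.dim k)) (Fin (t k)) (Ψ.lift g k)) := by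
  refine exists_congr fun r => exists_congr fun t => and_congr_right fun _ => and_congr_right
    fun _ => conj_iff_approxConj (Θ.mk_amp_lift r) (Ψ.mk_amp_lift t)

theorem SoficRep.approxConj_comb (t : unitInterval) (Θ Ψ : SoficRep ω G) :
    ApproxConj ω (SoficRep.comb t Θ Ψ).lift
      (fun g k => Equiv.Perm.sumCongrHom _ _
        (permAmp (Fin (Θ.dim k)) (Fin (Ψ.dim k * weightL t k)) (Θ.lift g k),
          permAmp (Fin (Ψ.dim k)) (Fin (Θ.dim k * weightR t k)) (Ψ.lift g k))) := by
  refine (conj_iff_approxConj (SoficRep.mk_lift _) fun g => ?_).1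
    (SoficRep.conj_comb t Θ Ψ).symm
  change _ = dsum ω _ _ (SoficSpace.amp _ Θ.hom g, SoficSpace.amp _ Ψ.hom g)
  rw [← SoficRep.mk_amp_lift Θ, ← SoficRep.mk_amp_lift Ψ]
  rfl

theorem SoficRep.dim_comb (t : unitInterval) (Θ Ψ : SoficRep ω G) (k : ℕ) :
    (SoficRep.comb t Θ Ψ).dim k = Θ.dim k * Ψ.dim k * (k + 1) := by
  change Θ.dim k * (Ψ.dim k * weightL t k) + Ψ.dim k * (Θ.dim k * weightR t k) = _
  rw [← weightL_add_weightR t k]; ring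

theorem tendsto_weightL (hω : (ω : Filter ℕ) ≤ cofinite) (t : unitInterval) :
    Tendsto (fun k => (weightL t k : ℝ) / ((k : ℝ) + 1)) ω (𝓝 (t : ℝ)) := by
  refine Tendsto.mono_left ?_ (hω.trans Nat.cofinite_eq_atTop.le)
  exact (tendsto_nat_floor_mul_div_atTop t.2.1).comp
    (tendsto_atTop_add_const_right _ (1 : ℝ) tendsto_natCast_atTop_atTop)

theorem tendsto_weightR (hω : (ω : Filter ℕ) ≤ cofinite) (t : unitInterval) :
    Tendsto (fun k => (weightR t k : ℝ) / ((k : ℝ) + 1)) ω (𝓝 (1 - t : ℝ)) := by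
  refine (tendsto_const_nhds.sub (tendsto_weightL hω t)).congr fun k => ?_
  have h : (weightL t k : ℝ) + weightR t k = k + 1 := by exact_mod_cast weightL_add_weightR t k
  have : (k : ℝ) + 1 ≠ 0 := by positivity
  field_simp
  linarith

variable {ι : Type} [Fintype ι] [DecidableEq ι]

/-- `IsMix Θ w Φ` expresses `[Φ] = ∑ i, w i • [Θ i]`: some amplification of `Φ` is approximately
conjugate to a block sum of amplifications of the `Θ i`, in which the `i`-th block has asymptotic
proportion `w i`. -/
def IsMix (Θ : ι → SoficRep ω G) (w : ι → ℝ) (Φ : SoficRep ω G) : Prop :=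
  ∃ (c : ℕ → ℕ) (a : ι → ℕ → ℕ), (∀ k, 0 < c k) ∧
    ApproxConj ω (fun g k => permAmp (Fin (Φ.dim k)) (Fin (c k)) (Φ.lift g k))
      (fun g k => blockAmp (fun i => a i k) fun i => (Θ i).lift g k) ∧
    ∀ i, Tendsto (fun k => ((Θ i).dim k * a i k : ℝ) / (Φ.dim k * c k)) ω (𝓝 (w i))

/-- The class of a convex combination depends only on the weights. -/
theorem IsMix.unique {Θ : ι → SoficRep ω G} {w : ι → ℝ} {Φ Φ' : SoficRep ω G}
    (h : IsMix Θ w Φ) (h' : IsMix Θ w Φ') : Φ ≈ Φ' := by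
  obtain ⟨c, a, hc, hP, ha⟩ := h
  obtain ⟨c', a', hc', hP', ha'⟩ := h'
  have hn : ∀ k, ∑ i, (Θ i).dim k * a i k = Φ.dim k * c k := fun k => by
    obtain ⟨e, -⟩ := hP
    simpa using (Fintype.card_congr (e k)).symm
  have hn' : ∀ k, ∑ i, (Θ i).dim k * a' i k = Φ'.dim k * c' k := fun k => by
    obtain ⟨e, -⟩ := hP'
    simpa using (Fintype.card_congr (e k)).symm
  have pos : ∀ k, 0 < Φ.dim k * c k := fun k => Nat.mul_pos (Φ.dim_pos k) (hc k)
  have pos' : ∀ k, 0 < Φ'.dim k * c' k := fun k => Nat.mul_pos (Φ'.dim_pos k) (hc' k)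
  have hs : ∀ k, ∑ i, (Θ i).dim k * (a i k * (Φ'.dim k * c' k))
      = Φ.dim k * c k * (Φ'.dim k * c' k) := fun k => by
    simp only [← mul_assoc, ← Finset.sum_mul]
    rw [hn]
  have hs' : ∀ k, ∑ i, (Θ i).dim k * (a' i k * (Φ.dim k * c k))
      = Φ.dim k * c k * (Φ'.dim k * c' k) := fun k => by
    rw [mul_comm (Φ.dim k * c k), ← hn', Finset.sum_mul]
    simp only [mul_assoc]
  -- amplifying each mixture by the size of the other one makes the sizes equal
  refine SoficRep.equivalent_iff.2 ⟨fun k => c k * (Φ'.dim k * c' k),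
    fun k => c' k * (Φ.dim k * c k), fun k => Nat.mul_pos (hc k) (pos' k),
    fun k => Nat.mul_pos (hc' k) (pos k), ?_⟩
  refine (ApproxConj.amp_amp _ fun k => rfl).symm.trans ((hP.amp _).trans
    ((ApproxConj.amp_blockAmp (fun i => (Θ i).lift) _ _).trans (ApproxConj.trans ?_
      (((ApproxConj.amp_amp _ fun k => rfl).symm.trans ((hP'.amp _).trans
    (ApproxConj.amp_blockAmp (fun i => (Θ i).lift) _ _))).symm))))
  refine ApproxConj.blockAmp (fun i => (Θ i).lift) _ _ (fun k => ?_) w (fun i => ?_) (fun i => ?_)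
  · simp only [Fintype.card_fin]
    rw [hs, hs']
  · refine (ha i).congr fun k => ?_
    simp only [Fintype.card_fin]
    rw [hs]
    push_cast
    rw [← mul_assoc, mul_div_mul_right _ _ (by exact_mod_cast (pos' k).ne')]
  · refine (ha' i).congr fun k => ?_
    simp only [Fintype.card_fin]
    rw [hs']
    push_cast
    rw [← mul_assoc, mul_comm ((Φ.dim k : ℝ) * c k),
      mul_div_mul_right _ _ (by exact_mod_cast (pos k).ne')]

/-- `[Θ i]` is the mixture with all its weight at `i`. -/
theorem IsMix.single (Θ : ι → SoficRep ω G) (i : ι) : IsMix Θ (Pi.single i 1) (Θ i) := by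
  refine ⟨fun _ => 1, fun j _ => if j = i then 1 else 0, fun _ => one_pos, ?_, fun j => ?_⟩
  · refine ApproxConj.symm (.of_equivariant (fun k => ?_) ?_)
    · exact
      { toFun := fun z => if h : z.1 = i then ⟨h ▸ z.2.1, 0⟩ else
          (Fin.cast (if_neg h) z.2.2).elim0
        invFun := fun z => ⟨i, z.1, ⟨0, by simp⟩⟩
        left_inv := by
          rintro ⟨j, x, y⟩
          by_cases h : j = i
          · subst h
            have : y = ⟨0, by simp⟩ :=
              Fin.ext (Nat.lt_one_iff.1 (lt_of_lt_of_eq y.2 (if_pos rfl)))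
            simp [this]
          · exact (Fin.cast (if_neg h) y).elim0
        right_inv := by
          rintro ⟨x, y⟩
          simp [Subsingleton.elim y 0] }
    · rintro g k ⟨j, x, y⟩
      by_cases h : j = i
      · subst h
        simp [blockAmp, permAmp]
      · exact (Fin.cast (if_neg h) y).elim0
  · rcases eq_or_ne j i with rfl | h
    · refine tendsto_const_nhds.congr fun k => ?_
      have := (Θ j).dim_pos k
      simp [this.ne']
    · simp [h]

/-- Mixtures of a fixed family combine by combining their weights, so that every identity between
convex combinations reduces, by `IsMix.unique`, to an identity between real weights. -/
theorem IsMix.comb (hω : (ω : Filter ℕ) ≤ cofinite) {Θ : ι → SoficRep ω G} {w w' : ι → ℝ}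
    {Φ Φ' : SoficRep ω G} (h : IsMix Θ w Φ) (h' : IsMix Θ w' Φ') (t : unitInterval) :
    IsMix Θ (fun i => t * w i + (1 - t) * w' i) (SoficRep.comb t Φ Φ') := by
  obtain ⟨c, a, hc, hP, ha⟩ := h
  obtain ⟨c', a', hc', hP', ha'⟩ := h'
  refine ⟨fun k => c k * c' k, fun i k => a i k * (Φ'.dim k * weightL t k * c' k)
    + a' i k * (Φ.dim k * weightR t k * c k), fun k => Nat.mul_pos (hc k) (hc' k), ?_, fun i => ?_⟩
  · have h1 := (ApproxConj.amp_amp (ω := ω) Φ.lift (c := c)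
        (d := fun k => Φ'.dim k * weightL t k * c' k)
        fun k => rfl).symm.trans ((hP.amp _).trans
        (ApproxConj.amp_blockAmp (fun i => (Θ i).lift) _ _))
    have h2 := (ApproxConj.amp_amp (ω := ω) Φ'.lift (c := c')
        (d := fun k => Φ.dim k * weightR t k * c k)
        fun k => rfl).symm.trans ((hP'.amp _).trans
        (ApproxConj.amp_blockAmp (fun i => (Θ i).lift) _ _))
    have h3 := ((SoficRep.approxConj_comb t Φ Φ').amp fun k => c k * c' k).trans
      (ApproxConj.amp_sum _ _ _)
    refine h3.trans ((ApproxConj.sum ?_ ?_).trans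
      ((h1.sum h2).trans (ApproxConj.sum_blockAmp (fun i => (Θ i).lift) _ _)))
    · exact ApproxConj.amp_amp _ fun k => by ring
    · exact ApproxConj.amp_amp _ fun k => by ring
  · refine (((tendsto_weightL hω t).mul (ha i)).add ((tendsto_weightR hω t).mul (ha' i))).congr
      fun k => ?_
    rw [SoficRep.dim_comb]
    have h1 : (Φ.dim k : ℝ) ≠ 0 := by exact_mod_cast (Φ.dim_pos k).ne'
    have h2 : (Φ'.dim k : ℝ) ≠ 0 := by exact_mod_cast (Φ'.dim_pos k).ne'
    have h3 : (c k : ℝ) ≠ 0 := by exact_mod_cast (hc k).ne'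
    have h4 : (c' k : ℝ) ≠ 0 := by exact_mod_cast (hc' k).ne'
    have h5 : (k : ℝ) + 1 ≠ 0 := by positivity
    push_cast
    field_simp

end Mix

/-! ### Convexity identities -/

section Identities

variable {G : Type*} [Group G] {ω : Ultrafilter ℕ}

theorem IsMix.mk_eq {ι : Type} [Fintype ι] [DecidableEq ι] {Θ : ι → SoficRep ω G} {w w' : ι → ℝ}
    {Φ Φ' : SoficRep ω G} (h : IsMix Θ w Φ) (h' : IsMix Θ w' Φ') (hw : ∀ i, w i = w' i) :
    (Quotient.mk _ Φ : Sof ω G) = Quotient.mk _ Φ' :=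
  Quotient.sound (h.unique (funext hw ▸ h'))

theorem Sof.comb_self (hω : (ω : Filter ℕ) ≤ cofinite) (t : unitInterval) (x : Sof ω G) :
    Sof.comb t x x = x := by
  induction x using Quotient.inductionOn with | _ Θ
  have h : IsMix ![Θ] _ Θ := IsMix.single _ 0
  refine (h.comb hω h t).mk_eq h fun i => ?_
  ring

theorem Sof.comb_one (hω : (ω : Filter ℕ) ≤ cofinite) (x y : Sof ω G) :
    Sof.comb 1 x y = x := by
  induction x using Quotient.inductionOn with | _ Θ
  induction y using Quotient.inductionOn with | _ Ψ
  have h : IsMix ![Θ, Ψ] _ Θ := IsMix.single _ 0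
  have h' : IsMix ![Θ, Ψ] _ Ψ := IsMix.single _ 1
  refine (h.comb hω h' 1).mk_eq h fun i => ?_
  simp

theorem Sof.comb_comm (hω : (ω : Filter ℕ) ≤ cofinite) (t : unitInterval) (x y : Sof ω G) :
    Sof.comb t x y = Sof.comb (unitInterval.symm t) y x := by
  induction x using Quotient.inductionOn with | _ Θ
  induction y using Quotient.inductionOn with | _ Ψ
  have h : IsMix ![Θ, Ψ] _ Θ := IsMix.single _ 0
  have h' : IsMix ![Θ, Ψ] _ Ψ := IsMix.single _ 1
  refine (h.comb hω h' t).mk_eq (h'.comb hω h _) fun i => ?_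
  rw [unitInterval.coe_symm_eq]
  ring

theorem Sof.comb_zero (hω : (ω : Filter ℕ) ≤ cofinite) (x y : Sof ω G) :
    Sof.comb 0 x y = y := by
  rw [Sof.comb_comm hω, unitInterval.symm_zero, Sof.comb_one hω]

theorem Sof.comb_assoc (hω : (ω : Filter ℕ) ≤ cofinite) {s t p u : unitInterval}
    (hp : (p : ℝ) = s * t) (hu : (1 - p : ℝ) * u = s * (1 - t)) (x y z : Sof ω G) :
    Sof.comb s (Sof.comb t x y) z = Sof.comb p x (Sof.comb u y z) := by
  induction x using Quotient.inductionOn with | _ A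
  induction y using Quotient.inductionOn with | _ B
  induction z using Quotient.inductionOn with | _ C
  have hA : IsMix ![A, B, C] _ A := IsMix.single _ 0
  have hB : IsMix ![A, B, C] _ B := IsMix.single _ 1
  have hC : IsMix ![A, B, C] _ C := IsMix.single _ 2
  refine ((hA.comb hω hB t).comb hω hC s).mk_eq (hA.comb hω (hB.comb hω hC u) p) fun i => ?_
  generalize (Pi.single (M := fun _ : Fin 3 => ℝ) 0 1 : Fin 3 → ℝ) i = a
  generalize (Pi.single (M := fun _ : Fin 3 => ℝ) 1 1 : Fin 3 → ℝ) i = b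
  generalize (Pi.single (M := fun _ : Fin 3 => ℝ) 2 1 : Fin 3 → ℝ) i = c
  linear_combination (c - a) * hp + (c - b) * hu

theorem Sof.comb_comb_comb_comm (hω : (ω : Filter ℕ) ≤ cofinite) (s t : unitInterval)
    (a b c d : Sof ω G) : Sof.comb s (Sof.comb t a b) (Sof.comb t c d)
      = Sof.comb t (Sof.comb s a c) (Sof.comb s b d) := by
  induction a using Quotient.inductionOn with | _ A
  induction b using Quotient.inductionOn with | _ B
  induction c using Quotient.inductionOn with | _ C
  induction d using Quotient.inductionOn with | _ D
  have hA : IsMix ![A, B, C, D] _ A := IsMix.single _ 0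
  have hB : IsMix ![A, B, C, D] _ B := IsMix.single _ 1
  have hC : IsMix ![A, B, C, D] _ C := IsMix.single _ 2
  have hD : IsMix ![A, B, C, D] _ D := IsMix.single _ 3
  refine ((hA.comb hω hB t).comb hω (hC.comb hω hD t) s).mk_eq
    ((hA.comb hω hC s).comb hω (hB.comb hω hD s) t) fun i => ?_
  ring

end Identities

/-! ### Closedness along segments -/

theorem defect_blockAmp_le {ι : Type} [Fintype ι] [DecidableEq ι] {X Y : ι → Type}
    [∀ i, Fintype (X i)] [∀ i, DecidableEq (X i)] [∀ i, Fintype (Y i)] [∀ i, DecidableEq (Y i)]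
    (a : ι → ℕ) (e : ∀ i, X i ≃ Y i) (p : ∀ i, Equiv.Perm (X i)) (q : ∀ i, Equiv.Perm (Y i)) :
    defect (Equiv.sigmaCongrRight fun i => (e i).prodCongr (Equiv.refl (Fin (a i))))
      (blockAmp a p) (blockAmp a q) ≤ ∑ i, defect (e i) (p i) (q i) := by
  have h : (Finset.univ.filter fun z : Σ i, X i × Fin (a i) =>
        (Equiv.sigmaCongrRight fun i => (e i).prodCongr (Equiv.refl (Fin (a i))))
          (blockAmp a p z) ≠ blockAmp a q
          ((Equiv.sigmaCongrRight fun i => (e i).prodCongr (Equiv.refl (Fin (a i)))) z))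
      = Finset.univ.sigma fun i => (Finset.univ.filter fun x => e i (p i x) ≠ q i (e i x))
          ×ˢ (Finset.univ : Finset (Fin (a i))) := by
    ext ⟨i, x, j⟩
    simp [blockAmp, permAmp]
  unfold defect
  rw [h, Finset.card_sigma]
  push_cast
  rw [Finset.sum_div]
  refine Finset.sum_le_sum fun i _ => ?_
  rw [Finset.card_product, Finset.card_univ, Fintype.card_fin]
  rcases Nat.eq_zero_or_pos (a i) with h0 | h0
  · rw [h0]; simp; positivity
  rcases isEmpty_or_nonempty (X i) with hX | hX
  · simp
  have hpos : 0 < Fintype.card (X i) := Fintype.card_pos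
  have hle : Fintype.card (X i) * a i ≤ Fintype.card (Σ i, X i × Fin (a i)) := by
    simp only [Fintype.card_sigma, Fintype.card_prod, Fintype.card_fin]
    exact Finset.single_le_sum (f := fun i => Fintype.card (X i) * a i)
      (fun _ _ => Nat.zero_le _) (Finset.mem_univ i)
  rw [← mul_div_mul_right _ (Fintype.card (X i) : ℝ) (c := (a i : ℝ)) (by positivity)]
  push_cast
  gcongr
  exact_mod_cast hle

theorem ApproxConj.blockAmp_congr {G : Type*} {ω : Ultrafilter ℕ} {ι : Type} [Fintype ι]
    [DecidableEq ι] {X Y : ι → ℕ → Type} [∀ i k, Fintype (X i k)] [∀ i k, DecidableEq (X i k)]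
    [∀ i k, Fintype (Y i k)] [∀ i k, DecidableEq (Y i k)] {P : ∀ i, G → ∀ k, Equiv.Perm (X i k)}
    {Q : ∀ i, G → ∀ k, Equiv.Perm (Y i k)} (h : ∀ i, ApproxConj ω (P i) (Q i)) (a : ι → ℕ → ℕ) :
    ApproxConj ω (fun g k => SoficSpace.blockAmp (fun i => a i k) fun i => P i g k)
      (fun g k => SoficSpace.blockAmp (fun i => a i k) fun i => Q i g k) := by
  choose e he using h
  refine ⟨_, fun g => squeeze_zero (fun _ => defect_nonneg _ _ _)
    (fun k => defect_blockAmp_le _ (fun i => e i k) _ _) ?_⟩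
  simpa using tendsto_finsetSum (Finset.univ : Finset ι) fun i _ => he i g

/-- Countably many sequences, depending on a parameter `j`, that tend to `0` along a free
ultrafilter for every fixed `j` still do so along some diagonal `j = J k` with `J k → ∞`. -/
theorem exists_diagonal {ω : Ultrafilter ℕ} (hω : (ω : Filter ℕ) ≤ cofinite) {I : Type*}
    [Countable I] (f : ℕ → I → ℕ → ℝ) (hf : ∀ j i, Tendsto (f j i) ω (𝓝 0)) :
    ∃ J : ℕ → ℕ, Tendsto J ω atTop ∧ ∀ i, Tendsto (fun k => f (J k) i k) ω (𝓝 0) := by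
  classical
  obtain ⟨enc, henc⟩ := Countable.exists_injective_nat I
  have hω' : (ω : Filter ℕ) ≤ atTop := hω.trans Nat.cofinite_eq_atTop.le
  have hev : ∀ n, ∀ᶠ k in (ω : Filter ℕ),
      n ≤ k ∧ ∀ i, enc i ≤ n → |f n i k| < 1 / ((n : ℝ) + 1) := by
    intro n
    have hfin : {i | enc i ≤ n}.Finite := (Set.finite_Iic n).preimage henc.injOn
    refine ((eventually_ge_atTop n).filter_mono hω').and ((hfin.eventually_all).2 fun i _ => ?_)
    have h1 : Tendsto (fun k => |f n i k|) ω (𝓝 0) := by simpa using (hf n i).abs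
    exact h1.eventually_lt_const (by positivity)
  -- `J k` is the largest `n ≤ k` for which the first `n` sequences are `1 / (n + 1)`-small at `k`
  let p : ℕ → ℕ → Prop := fun k n => n ≤ k ∧ ∀ i, enc i ≤ n → |f n i k| < 1 / ((n : ℝ) + 1)
  let J : ℕ → ℕ := fun k => Nat.findGreatest (p k) k
  have hJ : ∀ n k, p k n → n ≤ J k ∧ p k (J k) := fun n k h =>
    ⟨Nat.le_findGreatest h.1 h, Nat.findGreatest_spec h.1 h⟩
  refine ⟨J, tendsto_atTop.2 fun n => (hev n).mono fun k hk => (hJ n k hk).1, fun i => ?_⟩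
  rw [Metric.tendsto_nhds]
  intro ε hε
  obtain ⟨N, hN⟩ := exists_nat_one_div_lt hε
  filter_upwards [hev (max N (enc i))] with k hk
  obtain ⟨h1, -, h2⟩ := hJ _ k hk
  have h3 := h2 i ((le_max_right _ _).trans h1)
  have h4 : (N : ℝ) ≤ J k := by exact_mod_cast (le_max_left _ _).trans h1
  rw [Real.dist_eq, sub_zero]
  refine h3.trans_le (le_trans ?_ hN.le)
  gcongr

section Closed

variable {G : Type*} [Group G] {ω : Ultrafilter ℕ}

theorem SoficRep.tendsto_hammingDist_lift_mul (Θ : SoficRep ω G) (g h : G) :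
    Tendsto (fun k => hammingDist (Θ.lift (g * h) k) (Θ.lift g k * Θ.lift h k)) ω (𝓝 0) := by
  refine (mk_eq_mk_iff (Θ.lift (g * h)) (Θ.lift g * Θ.lift h)).1 ?_
  change _ = UProd.mk ω (Θ.lift g) * UProd.mk ω (Θ.lift h)
  rw [Θ.mk_lift, Θ.mk_lift, Θ.mk_lift, map_mul]

theorem SoficRep.tendsto_normTrace_lift (Θ : SoficRep ω G) {g : G} (hg : g ≠ 1) :
    Tendsto (fun k => normTrace (Θ.lift g k)) ω (𝓝 0) := by
  obtain ⟨p, hp, hp'⟩ := Θ.trace_zero g hg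
  rw [← Θ.mk_lift, mk_eq_mk_iff] at hp
  refine squeeze_zero (fun _ => normTrace_nonneg _) (fun k => ?_) (by simpa using hp'.add hp)
  have := (abs_le.1 (abs_normTrace_sub_le (p k) (Θ.lift g k))).1
  linarith

/-- The sofic representation assembled from the permutations of `Λ (J k)` at stage `k`. The
amplification by `k + 1` forces the dimensions to tend to infinity at all stages, and not only
along `ω`. -/
noncomputable def SoficRep.diagonal (Λ : ℕ → SoficRep ω G) (J : ℕ → ℕ)
    (hmul : ∀ g h, Tendsto (fun k => hammingDist ((Λ (J k)).lift (g * h) k)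
      ((Λ (J k)).lift g k * (Λ (J k)).lift h k)) ω (𝓝 0))
    (htr : ∀ g, g ≠ 1 → Tendsto (fun k => normTrace ((Λ (J k)).lift g k)) ω (𝓝 0)) :
    SoficRep ω G where
  dim k := (Λ (J k)).dim k * (k + 1)
  dim_pos k := Nat.mul_pos ((Λ (J k)).dim_pos k) k.succ_pos
  tendsto_dim := tendsto_atTop_mono (fun k => (Nat.le_succ k).trans
    (Nat.le_mul_of_pos_left _ ((Λ (J k)).dim_pos k))) tendsto_id
  hom := (reindex ω (fun _ => finProdFinEquiv)).comp ((amplify ω _ (fun k => Fin (k + 1))).comp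
    (MonoidHom.mk' (fun g => UProd.mk ω fun k => (Λ (J k)).lift g k) fun g h =>
      (mk_eq_mk_iff _ _).2 (hmul g h)))
  trace_zero g hg := by
    refine ⟨fun k => finProdFinEquiv.permCongr
      (permAmp _ (Fin (k + 1)) ((Λ (J k)).lift g k)), rfl, ?_⟩
    refine squeeze_zero (fun _ => normTrace_nonneg _) (fun k => ?_) (htr g hg)
    rw [normTrace_permCongr]
    exact normTrace_permAmp_le _

theorem SoficRep.approxConj_diagonal (Λ : ℕ → SoficRep ω G) (J : ℕ → ℕ) (hmul htr) :
    ApproxConj ω (fun g k => permAmp _ (Fin (k + 1)) ((Λ (J k)).lift g k))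
      (SoficRep.diagonal Λ J hmul htr).lift := by
  have h : Conj ((amplify ω _ (fun k => Fin (k + 1))).comp
      (MonoidHom.mk' (fun g => UProd.mk ω fun k => (Λ (J k)).lift g k) fun g h =>
        (mk_eq_mk_iff _ _).2 (hmul g h))) (SoficRep.diagonal Λ J hmul htr).hom :=
    ⟨fun _ => finProdFinEquiv, fun _ => rfl⟩
  exact (conj_iff_approxConj (fun _ => rfl) (SoficRep.mk_lift _)).1 h

theorem SoficRep.diagonal_const (Ψ : SoficRep ω G) (J : ℕ → ℕ) (hmul htr) :
    SoficRep.diagonal (fun _ => Ψ) J hmul htr ≈ Ψ := by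
  refine SoficRep.equivalent_iff.2 ⟨fun _ => 1, fun k => k + 1, fun _ => one_pos,
    fun k => k.succ_pos, ?_⟩
  refine ((SoficRep.approxConj_diagonal (fun _ => Ψ) J hmul htr).symm.amp _).trans ?_
  exact ApproxConj.amp_amp (ω := ω) Ψ.lift (c := fun k => k + 1) (d := fun _ => 1)
    fun k => mul_one _

variable {ι : Type} [Fintype ι] [DecidableEq ι]

theorem IsMix.of_equiv {Θ : ι → SoficRep ω G} {w : ι → ℝ} {Φ Φ' : SoficRep ω G}
    (h : IsMix Θ w Φ) (hΦ : Φ' ≈ Φ) : IsMix Θ w Φ' := by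
  obtain ⟨c, a, hc, hP, ha⟩ := h
  obtain ⟨r, t, hr, ht, hrt⟩ := SoficRep.equivalent_iff.1 hΦ
  have hdim : ∀ k, Φ'.dim k * r k = Φ.dim k * t k := fun k => by
    obtain ⟨e, -⟩ := hrt
    simpa using Fintype.card_congr (e k)
  refine ⟨fun k => r k * c k, fun i k => a i k * t k, fun k => Nat.mul_pos (hr k) (hc k), ?_,
    fun i => ?_⟩
  · refine (ApproxConj.amp_amp _ fun k => rfl).symm.trans ((hrt.amp c).trans
      ((ApproxConj.amp_amp _ fun k => mul_comm (t k) (c k)).trans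
      ((ApproxConj.amp_amp _ fun k => rfl).symm.trans ((hP.amp t).trans
      (ApproxConj.amp_blockAmp (fun i => (Θ i).lift) _ _)))))
  · refine (ha i).congr fun k => ?_
    have h1 : (Φ'.dim k : ℝ) * r k = Φ.dim k * t k := by exact_mod_cast hdim k
    have h2 : (t k : ℝ) ≠ 0 := by exact_mod_cast (ht k).ne'
    push_cast
    rw [← mul_assoc, ← mul_assoc, h1, mul_right_comm (Φ.dim k : ℝ), mul_div_mul_right _ _ h2]

/-- If `Φ` is a mixture of the family `(Λ i j)_i` for every `j`, with weights that converge as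
`j → ∞`, then it is a mixture, with the limit weights, of a family of diagonals of the `Λ i`. One
diagonal `J` serves all `i`; it has to respect multiplicativity and vanishing traces for all group
elements, whence the countability of `G`. -/
theorem IsMix.exists_diagonal [Countable G] (hω : (ω : Filter ℕ) ≤ cofinite)
    {Λ : ι → ℕ → SoficRep ω G} {w : ℕ → ι → ℝ} {v : ι → ℝ} {Φ : SoficRep ω G}
    (h : ∀ j, IsMix (fun i => Λ i j) (w j) Φ)
    (hw : ∀ i, Tendsto (fun j => w j i) atTop (𝓝 (v i))) :
    ∃ (J : ℕ → ℕ)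
      (hmul : ∀ i g h, Tendsto (fun k => hammingDist ((Λ i (J k)).lift (g * h) k)
        ((Λ i (J k)).lift g k * (Λ i (J k)).lift h k)) ω (𝓝 0))
      (htr : ∀ i g, g ≠ 1 → Tendsto (fun k => normTrace ((Λ i (J k)).lift g k)) ω (𝓝 0)),
      IsMix (fun i => SoficRep.diagonal (Λ i) J (hmul i) (htr i)) v Φ := by
  simp only [IsMix, ApproxConj] at h
  choose c a hc h ha using h
  choose e he using h
  obtain ⟨J, hJ, hJf⟩ := SoficSpace.exists_diagonal hω
    (I := (ι × G × G) ⊕ (ι × {g : G // g ≠ 1}) ⊕ G ⊕ ι)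
    (fun j => Sum.elim
      (fun q k => hammingDist ((Λ q.1 j).lift (q.2.1 * q.2.2) k)
        ((Λ q.1 j).lift q.2.1 k * (Λ q.1 j).lift q.2.2 k))
      (Sum.elim (fun q k => normTrace ((Λ q.1 j).lift q.2 k))
      (Sum.elim
        (fun g k => defect (e j k) (permAmp (Fin (Φ.dim k)) (Fin (c j k)) (Φ.lift g k))
          (blockAmp (fun i => a j i k) fun i => (Λ i j).lift g k))
        (fun i k => ((Λ i j).dim k * a j i k : ℝ) / (Φ.dim k * c j k) - w j i)))) (by
      rintro j (q | q | g | i)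
      · exact (Λ q.1 j).tendsto_hammingDist_lift_mul _ _
      · exact (Λ q.1 j).tendsto_normTrace_lift q.2.2
      · exact he j g
      · simpa using (ha j i).sub_const (w j i))
  refine ⟨J, fun i g h => hJf (.inl (i, g, h)), fun i g hg => hJf (.inr (.inl (i, ⟨g, hg⟩))),
    fun k => c (J k) k * (k + 1), fun i k => a (J k) i k,
    fun k => Nat.mul_pos (hc _ _) k.succ_pos, ?_, fun i => ?_⟩
  · have h1 : ApproxConj ω (fun g k => permAmp (Fin (Φ.dim k)) (Fin (c (J k) k)) (Φ.lift g k))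
        (fun g k => blockAmp (fun i => a (J k) i k) fun i => (Λ i (J k)).lift g k) :=
      ⟨fun k => e (J k) k, fun g => hJf (.inr (.inr (.inl g)))⟩
    have h2 : ApproxConj ω
        (fun g k => blockAmp (fun i => a (J k) i k * (k + 1)) fun i => (Λ i (J k)).lift g k)
        (fun g k => blockAmp (fun i => a (J k) i k)
          fun i => permAmp _ (Fin (k + 1)) ((Λ i (J k)).lift g k)) :=
      .of_equivariant (fun k => Equiv.sigmaCongrRight fun i =>
        ((Equiv.refl _).prodCongr (finProdFinEquiv.symm.trans (Equiv.prodComm _ _))).trans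
          (Equiv.prodAssoc _ _ _).symm) fun _ _ _ => rfl
    refine (ApproxConj.amp_amp _ fun k => rfl).symm.trans ((h1.amp fun k => k + 1).trans
      ((ApproxConj.amp_blockAmp (B := fun i k => Fin ((Λ i (J k)).dim k))
        (fun i g k => (Λ i (J k)).lift g k) (fun i k => a (J k) i k) _).trans (h2.trans ?_)))
    exact ApproxConj.blockAmp_congr
      (fun i => SoficRep.approxConj_diagonal (Λ i) J _ _) fun i k => a (J k) i k
  · have h1 : Tendsto (fun k => ((Λ i (J k)).dim k * a (J k) i k : ℝ) / (Φ.dim k * c (J k) k)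
        - w (J k) i) ω (𝓝 0) := hJf (.inr (.inr (.inr i)))
    have h2 := h1.add ((hw i).comp hJ)
    rw [zero_add] at h2
    refine h2.congr fun k => ?_
    change _ = (((Λ i (J k)).dim k * (k + 1) : ℕ) * a (J k) i k : ℝ) / _
    have h5 : (k : ℝ) + 1 ≠ 0 := by positivity
    push_cast
    simp only [Function.comp_apply, sub_add_cancel]
    rw [← mul_assoc, mul_right_comm, mul_div_mul_right _ _ h5]

/-- The set of weights with which `y` occurs in `x` is closed. -/
theorem Sof.isClosed_setOf_comb_eq [Countable G] (hω : (ω : Filter ℕ) ≤ cofinite)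
    (x y : Sof ω G) : IsClosed {t : unitInterval | ∃ z, Sof.comb t y z = x} := by
  refine IsSeqClosed.isClosed fun s S hs hS => ?_
  choose z hz using hs
  induction x using Quotient.inductionOn with | _ Θ
  induction y using Quotient.inductionOn with | _ Ψ
  have hrep : ∀ j, ∃ Φ : SoficRep ω G, Quotient.mk _ Φ = z j := fun j => Quotient.exists_rep _
  choose Φ hΦ using hrep
  have hmix : ∀ j, IsMix (fun i => (![fun _ => Ψ, Φ] : Fin 2 → ℕ → SoficRep ω G) i j) _ Θ :=
    fun j => by
      have h : IsMix (fun i => (![fun _ => Ψ, Φ] : Fin 2 → ℕ → SoficRep ω G) i j) _ Ψ :=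
        IsMix.single _ 0
      have h' : IsMix (fun i => (![fun _ => Ψ, Φ] : Fin 2 → ℕ → SoficRep ω G) i j) _ (Φ j) :=
        IsMix.single _ 1
      refine (h.comb hω h' (s j)).of_equiv (Quotient.exact ?_)
      rw [← hz j, ← hΦ j]
      rfl
  have hS' : Tendsto (fun j => (s j : ℝ)) atTop (𝓝 (S : ℝ)) :=
    (continuous_subtype_val.tendsto S).comp hS
  obtain ⟨J, hmul, htr, hJ⟩ := IsMix.exists_diagonal hω hmix fun i =>
    (hS'.mul_const _).add ((hS'.const_sub 1).mul_const _)
  refine ⟨Quotient.mk _ (SoficRep.diagonal Φ J (hmul 1) (htr 1)), ?_⟩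
  have e1 : (Quotient.mk _ Ψ : Sof ω G)
      = Quotient.mk _ (SoficRep.diagonal (fun _ => Ψ) J (hmul 0) (htr 0)) :=
    (Quotient.sound (SoficRep.diagonal_const Ψ J _ _)).symm
  rw [e1]
  have h0 := IsMix.single (fun i : Fin 2 => SoficRep.diagonal
    ((![fun _ => Ψ, Φ] : Fin 2 → ℕ → SoficRep ω G) i) J (hmul i) (htr i)) 0
  have h1 := IsMix.single (fun i : Fin 2 => SoficRep.diagonal
    ((![fun _ => Ψ, Φ] : Fin 2 → ℕ → SoficRep ω G) i) J (hmul i) (htr i)) 1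
  exact (h0.comb hω h1 S).mk_eq hJ fun i => rfl

end Closed

/-! ### Faces -/

section Faces

variable {G : Type*} [Group G] {ω : Ultrafilter ℕ}

/-- The face generated by `x`: the points that occur in `x` with a weight strictly between `0`
and `1`. -/
def faceOf (x : Sof ω G) : Set (Sof ω G) :=
  {y | ∃ (t : unitInterval) (z : Sof ω G), 0 < t ∧ t < 1 ∧ Sof.comb t y z = x}

theorem mem_faceOf_self (hω : (ω : Filter ℕ) ≤ cofinite) (x : Sof ω G) : x ∈ faceOf x :=
  ⟨⟨1 / 2, by norm_num, by norm_num⟩, x, by rw [← Subtype.coe_lt_coe]; norm_num,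
    by rw [← Subtype.coe_lt_coe]; norm_num, Sof.comb_self hω _ x⟩

/-- One-sided associativity, with the explicit weight `s (1 - t) / (1 - s t)` of `y` in `z'` left
aside. -/
theorem exists_comb_comb_eq (hω : (ω : Filter ℕ) ≤ cofinite) {s t : unitInterval} (hst : s * t < 1)
    (x y z : Sof ω G) : ∃ z', Sof.comb s (Sof.comb t x y) z = Sof.comb (s * t) x z' := by
  have h1 : (0 : ℝ) < 1 - s * t := sub_pos.2 hst
  refine ⟨Sof.comb ⟨s * (1 - t) / (1 - s * t), div_nonneg (mul_nonneg s.2.1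
    (sub_nonneg.2 t.2.2)) h1.le, (div_le_one h1).2 (by nlinarith [s.2.2])⟩ y z,
    Sof.comb_assoc hω rfl ?_ x y z⟩
  rw [Set.Icc.coe_mul]
  field_simp

/-- A point that occurs in `x` with weight `t` occurs in `x` with every smaller weight. -/
theorem exists_comb_mul_eq (hω : (ω : Filter ℕ) ≤ cofinite) {x y z : Sof ω G} {t : unitInterval}
    (ht : t < 1) (h : Sof.comb t y z = x) (s : unitInterval) :
    ∃ z', Sof.comb (s * t) y z' = x := by
  obtain ⟨z', hz'⟩ := exists_comb_comb_eq hω (unitInterval.mul_le_right.trans_lt ht : s * t < 1)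
    y z x
  exact ⟨z', by rw [← hz', h, Sof.comb_self hω]⟩

theorem isFace_faceOf (hω : (ω : Filter ℕ) ≤ cofinite) (x : Sof ω G) : IsFace (faceOf x) where
  nonempty := ⟨x, mem_faceOf_self hω x⟩
  convex := by
    rintro u ⟨t, z, ht, ht1, h⟩ u' ⟨t', z', ht', ht1', h'⟩ s
    -- lowering both weights to `t' t` lets the two decompositions of `x` be combined termwise
    obtain ⟨a, ha⟩ := exists_comb_mul_eq hω ht1 h t'
    obtain ⟨b, hb⟩ := exists_comb_mul_eq hω ht1' h' t
    rw [mul_comm] at hb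
    refine ⟨t' * t, Sof.comb s a b, ?_, ?_, ?_⟩
    · rw [← Subtype.coe_lt_coe]
      exact mul_pos ht' ht
    · exact unitInterval.mul_le_left.trans_lt ht1'
    · rw [Sof.comb_comb_comb_comm hω, ha, hb, Sof.comb_self hω]
  extremal := by
    have key : ∀ (u v : Sof ω G) (t : unitInterval), 0 < t → t < 1 →
        Sof.comb t u v ∈ faceOf x → u ∈ faceOf x := by
      rintro u v t ht ht1 ⟨s, z, hs, hs1, h⟩
      have hst : s * t < 1 := unitInterval.mul_le_left.trans_lt hs1
      obtain ⟨z', hz'⟩ := exists_comb_comb_eq hω hst u v z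
      refine ⟨s * t, z', ?_, hst, by rw [← hz', h]⟩
      rw [← Subtype.coe_lt_coe]
      exact mul_pos hs ht
    intro u v t ht ht1 h
    refine ⟨key u v t ht ht1 h, key v u (unitInterval.symm t) ?_ ?_ ?_⟩
    · exact unitInterval.pos_iff_ne_zero.2 fun h => ht1.ne (unitInterval.symm_eq_zero.1 h)
    · exact unitInterval.lt_one_iff_ne_one.2 fun h => ht.ne' (unitInterval.symm_eq_one.1 h)
    · rwa [← Sof.comb_comm hω]

/-- The ray from `y` through `x ≠ y` has a last point `w`, because the weights with which `y`
occurs in `x` form a compact set. As the ray ends at `w`, the point `y` is not in the face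
generated by `w`. -/
theorem exists_comb_eq_notMem_faceOf [Countable G] (hω : (ω : Filter ℕ) ≤ cofinite)
    {x y : Sof ω G} (hxy : x ≠ y) :
    ∃ (t : unitInterval) (w : Sof ω G), t < 1 ∧ Sof.comb t y w = x ∧ y ∉ faceOf w := by
  obtain ⟨t, ⟨w, hw⟩, hmax⟩ := (Sof.isClosed_setOf_comb_eq hω x y).isCompact.exists_isGreatest
    ⟨0, x, Sof.comb_zero hω y x⟩
  have ht : t < 1 := unitInterval.lt_one_iff_ne_one.2 (by
    rintro rfl
    exact hxy (by rw [← hw, Sof.comb_one hω]))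
  refine ⟨t, w, ht, hw, ?_⟩
  rintro ⟨u, z, hu, hu1, h⟩
  -- `x = t y + (1 - t) (u y + (1 - u) z)` contains `y` with weight `t + (1 - t) u > t`
  have ht' : (t : ℝ) < 1 := ht
  have hu' : (0 : ℝ) < u := hu
  have h1 : (0 : ℝ) < t + (1 - t) * u :=
    add_pos_of_nonneg_of_pos t.2.1 (mul_pos (by linarith) hu')
  let s : unitInterval := ⟨t + (1 - t) * u, h1.le, by nlinarith [u.2.2]⟩
  let r : unitInterval := ⟨t / (t + (1 - t) * u), div_nonneg t.2.1 h1.le,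
    (div_le_one h1).2 (by nlinarith)⟩
  have hs : Sof.comb s y z = x := by
    rw [← hw, ← h, ← Sof.comb_assoc hω (s := s) (t := r) (p := t) (u := u)
      (by simp only [s, r]; field_simp) (by simp only [s, r]; field_simp; ring) y y z,
      Sof.comb_self hω]
  have hle : (s : ℝ) ≤ t := hmax ⟨z, hs⟩
  simp only [s] at hle
  nlinarith

theorem isFace_singleton_iff (hω : (ω : Filter ℕ) ≤ cofinite) (x : Sof ω G) :
    IsFace {x} ↔ IsExtremePoint x := by
  refine ⟨fun h y z t ht ht1 hx => h.extremal y z t ht ht1 hx, fun h => ⟨⟨x, rfl⟩, ?_, ?_⟩⟩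
  · rintro _ rfl _ rfl t
    exact Sof.comb_self hω t _
  · exact fun y z t ht ht1 hx => h y z t ht ht1 hx

theorem IsMinimalFace.subsingleton [Countable G] (hω : (ω : Filter ℕ) ≤ cofinite)
    {F : Set (Sof ω G)} (hF : IsMinimalFace F) : F.Subsingleton := by
  intro x hx y hy
  by_contra hxy
  obtain ⟨t, w, ht, hw, hyw⟩ := exists_comb_eq_notMem_faceOf hω hxy
  have hwF : w ∈ F := by
    rcases eq_or_ne t 0 with rfl | h0
    · rw [Sof.comb_zero hω] at hw
      rwa [hw]
    · exact (hF.1.extremal y w t (unitInterval.pos_iff_ne_zero.2 h0) ht (by rwa [hw])).2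
  have hsub : faceOf w ⊆ F := by
    rintro u ⟨s, z, hs, hs1, h⟩
    exact (hF.1.extremal u z s hs hs1 (by rwa [h])).1
  rw [hF.2 _ (isFace_faceOf hω w) hsub] at hyw
  exact hyw hy

end Faces

end SoficSpace

theorem mainTheorem1 (ω : Ultrafilter ℕ) (hω : (ω : Filter ℕ) ≤ Filter.cofinite)
    (G : Type*) [Group G] [Countable G] (F : Set (SoficSpace.Sof ω G)) :
    SoficSpace.IsMinimalFace F ↔ ∃ x, SoficSpace.IsExtremePoint x ∧ F = {x} := by
  constructor
  · intro hF
    obtain ⟨x, hx⟩ := hF.1.nonempty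
    have h : F = {x} := (hF.subsingleton hω).eq_singleton_of_mem hx
    exact ⟨x, (SoficSpace.isFace_singleton_iff hω x).1 (h ▸ hF.1), h⟩
  · rintro ⟨x, hx, rfl⟩
    exact ⟨(SoficSpace.isFace_singleton_iff hω x).2 hx,
      fun F' hF' hsub => (Set.subset_singleton_iff_eq.1 hsub).resolve_left hF'.nonempty.ne_empty⟩
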